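/- Let $(x_i,y_i)_{i\in I}$, $I=\{0,\dots,N-1\}$, be data with $x_i\in\mathbb R^d$, $y_i\in\{-1,+1\}$, and let $I=\biguplus_{j=0}^{M-1} I_j$ be a partition into $M$ tasks with losses $\mathcal L_j(w)=\sum_{i\in I_j}\ell(y_i x_i^\top w)$. Sequential gradient descent with learning rate $\eta>0$ and $K\ge 1$ steps per stage, started at an arbitrary $w^{(0)}_0\in\mathbb R^d$, is $$w^{(t)}_{k+1}=w^{(t)}_k-\eta\nabla\mathcal L_{m_t}(w^{(t)}_k)\quad(0\le k\le K-1),\qquad w^{(t+1)}_0=w^{(t)}_K,$$ where the tasks $m_0,m_1,\dots$ are independent and uniformly distributed on $\{0,\dots,M-1\}$. Assume: 1. (Joint separability) some $w$ satisfies $y_ix_i^\top w>0$ for all $i\in I$. Let $\hat w=\arg\min\{\|w\|^2 : y_ix_i^\top w\ge 1\ \forall i\in I\}$, $\phi=\min_{i\in I} y_ix_i^\top\hat w/\|\hat w\|$, and let $S=\{i\in I: y_ix_i^\top\hat w/\|\hat w\|=\phi\}$ be the index set of the support vectors. 2. (Non-degeneracy) there are unique numbers $\alpha_i>0$ $(i\in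 S)$ with $\hat w=\sum_{i\in S}\alpha_i y_i x_i$. 3. (Loss shape) $\ell:\mathbb R\to\mathbb R$ is positive, differentiable and $\beta$-smooth (i.e. $\ell'$ is $\beta$-Lipschitz), decreases to zero with $\ell'<0$ everywhere and $\lim_{u\to+\infty}\ell(u)=0$, and $\limsup_{u\to-\infty}\ell'(u)<0$. 4. (Tight exponential tail) there are $\mu_+,\mu_-,\bar u>0$ such that $(1-e^{-\mu_-u})e^{-u}\le-\ell'(u)\le(1+e^{-\mu_+u})e^{-u}$ for all $u>\bar u$. 5. $\eta<\dfrac{2\phi^2}{\beta\sigma_{\max}^4}$, where $\sigma_{\max}=\sqrt{\lambda_{\max}(XX^\top)}$ and $X\in\mathbb R^{d\times N}$ has columns $x_i$. 6. $\operatorname{rank}\{x_i:i\in S\}=\operatorname{rank}\{x_i:i\in I\}$. 7. Every task contains a support vector: $S\cap I_j\ne\emptyset$ for all $j$. Let $P$ be the orthogonal projection onto $\operatorname{span}\{x_i:i\in S\}$. Then the system $$\eta\exp(-y_ix_i^\top\tilde w)=\alpha_i\quad\forall i\in S,\qquad (\mathrm{Id}-P)(\tilde w-w^{(0)}_0)=0$$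 has a unique solution $\tilde w\in\mathbb R^d$, and, with probability $1$, for all $k\in\{0,\dots,K-1\}$ the residual $\rho^{(t)}_k$ defined by $w^{(t)}_k=\ln\!\big(\tfrac{K}{M}t\big)\hat w+\rho^{(t)}_k$ satisfies $$\lim_{t\to\infty}\rho^{(t)}_k=\tilde w;$$ equivalently, $\lim_{t\to\infty}\big(w^{(t)}_k-\ln(t)\,\hat w\big)=\ln\!\big(\tfrac KM\big)\hat w+\tilde w$. -/

import Mathlib

open MeasureTheory ProbabilityTheory Filter Topology

namespace ContinualGD

noncomputable section

variable {d N M : ℕ}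

/-- The joint data matrix, a `d × N` matrix whose columns are the data points. -/
def dataMatrix (x : Fin N → EuclideanSpace ℝ (Fin d)) : Matrix (Fin d) (Fin N) ℝ :=
  Matrix.of fun j i => x i j

/-- The largest real eigenvalue of a square matrix (used for symmetric matrices only). -/
def lambdaMax (A : Matrix (Fin d) (Fin d) ℝ) : ℝ :=
  sSup (spectrum ℝ A)

/-- The maximum singular value `√(λ_max(X Xᵀ))` of the data matrix. -/
def sigmaMax (x : Fin N → EuclideanSpace ℝ (Fin d)) : ℝ :=
  Real.sqrt (lambdaMax (dataMatrix x * (dataMatrix x).transpose))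

/-- The training loss `∑ i ∈ J, ℓ (yᵢ xᵢᵀ w)` of the data indexed by `J`. -/
def taskLoss (ℓ : ℝ → ℝ) (x : Fin N → EuclideanSpace ℝ (Fin d)) (y : Fin N → ℝ)
    (J : Finset (Fin N)) (w : EuclideanSpace ℝ (Fin d)) : ℝ :=
  ∑ i ∈ J, ℓ (y i * inner ℝ (x i) w)

/-- One gradient descent step with learning rate `η` on the loss of the data indexed by `J`. -/
def gdStep (ℓ : ℝ → ℝ) (η : ℝ) (x : Fin N → EuclideanSpace ℝ (Fin d)) (y : Fin N → ℝ)
    (J : Finset (Fin N)) (w : EuclideanSpace ℝ (Fin d)) : EuclideanSpace ℝ (Fin d) :=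
  w - η • gradient (taskLoss ℓ x y J) w

/-- The iterate at the beginning of stage `t`, where `m t` is the task of stage `t` and each stage
consists of `K` gradient descent steps. -/
def stageStart (ℓ : ℝ → ℝ) (η : ℝ) (K : ℕ) (x : Fin N → EuclideanSpace ℝ (Fin d))
    (y : Fin N → ℝ) (I : Fin M → Finset (Fin N)) (m : ℕ → Fin M)
    (w₀ : EuclideanSpace ℝ (Fin d)) : ℕ → EuclideanSpace ℝ (Fin d)
  | 0 => w₀
  | t + 1 => (gdStep ℓ η x y (I (m t)))^[K] (stageStart ℓ η K x y I m w₀ t)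

/-- The sequential gradient descent iterate after `k` steps of stage `t`. -/
def seqGD (ℓ : ℝ → ℝ) (η : ℝ) (K : ℕ) (x : Fin N → EuclideanSpace ℝ (Fin d))
    (y : Fin N → ℝ) (I : Fin M → Finset (Fin N)) (m : ℕ → Fin M)
    (w₀ : EuclideanSpace ℝ (Fin d)) (t k : ℕ) : EuclideanSpace ℝ (Fin d) :=
  (gdStep ℓ η x y (I (m t)))^[k] (stageStart ℓ η K x y I m w₀ t)

/-- Joint linear separability. -/
def JointlySeparable (x : Fin N → EuclideanSpace ℝ (Fin d)) (y : Fin N → ℝ) : Prop :=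
  ∃ w : EuclideanSpace ℝ (Fin d), ∀ i, 0 < y i * inner ℝ (x i) w

/-- `w` minimizes `‖w‖²` subject to `yᵢ xᵢᵀ w ≥ 1` for all `i`. -/
def IsMaxMargin (x : Fin N → EuclideanSpace ℝ (Fin d)) (y : Fin N → ℝ)
    (w : EuclideanSpace ℝ (Fin d)) : Prop :=
  (∀ i, 1 ≤ y i * inner ℝ (x i) w) ∧
    ∀ v : EuclideanSpace ℝ (Fin d), (∀ i, 1 ≤ y i * inner ℝ (x i) v) → ‖w‖ ^ 2 ≤ ‖v‖ ^ 2

/-- The joint max-margin solution. -/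
def maxMargin (x : Fin N → EuclideanSpace ℝ (Fin d)) (y : Fin N → ℝ) :
    EuclideanSpace ℝ (Fin d) :=
  Classical.epsilon (IsMaxMargin x y)

/-- On separable data the max-margin problem has a unique solution, and `maxMargin` is it. -/
theorem isMaxMargin_iff {x : Fin N → EuclideanSpace ℝ (Fin d)} {y : Fin N → ℝ}
    (h : JointlySeparable x y) (w : EuclideanSpace ℝ (Fin d)) :
    IsMaxMargin x y w ↔ w = maxMargin x y := by
  have hconv : Convex ℝ {v : EuclideanSpace ℝ (Fin d) | ∀ i, 1 ≤ y i * inner ℝ (x i) v} := by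
    intro u hu v hv a b ha hb hab i
    simp only [Set.mem_ofPred_eq] at hu hv
    rw [inner_add_right, inner_smul_right, inner_smul_right]
    nlinarith [mul_le_mul_of_nonneg_left (hu i) ha, mul_le_mul_of_nonneg_left (hv i) hb]
  have hclosed : IsClosed {v : EuclideanSpace ℝ (Fin d) | ∀ i, 1 ≤ y i * inner ℝ (x i) v} := by
    rw [Set.ofPred_forall]
    refine isClosed_iInter fun i => ?_
    exact isClosed_le continuous_const (by fun_prop)
  have hne : {v : EuclideanSpace ℝ (Fin d) | ∀ i, 1 ≤ y i * inner ℝ (x i) v}.Nonempty := by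
    obtain ⟨u, hu⟩ := h
    refine ⟨(∑ i, (y i * inner ℝ (x i) u)⁻¹) • u, fun i => ?_⟩
    rw [inner_smul_right]
    have h1 : (y i * inner ℝ (x i) u)⁻¹ ≤ ∑ j, (y j * inner ℝ (x j) u)⁻¹ :=
      Finset.single_le_sum (f := fun j => (y j * inner ℝ (x j) u)⁻¹)
        (fun j _ => (inv_pos.2 (hu j)).le) (Finset.mem_univ i)
    have h2 := mul_le_mul_of_nonneg_right h1 (hu i).le
    rw [inv_mul_cancel₀ (hu i).ne'] at h2
    linarith
  have hex : ∃ v, IsMaxMargin x y v := by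
    obtain ⟨v, hv, hmin⟩ := exists_norm_eq_iInf_of_complete_convex hne hclosed.isComplete hconv 0
    refine ⟨v, hv, fun u hu => ?_⟩
    have hle : ‖(0 : EuclideanSpace ℝ (Fin d)) - v‖ ≤ ‖(0 : EuclideanSpace ℝ (Fin d)) - u‖ := by
      rw [hmin]
      exact ciInf_le (f := fun z : {v : EuclideanSpace ℝ (Fin d) |
          ∀ i, 1 ≤ y i * inner ℝ (x i) v} => ‖(0 : EuclideanSpace ℝ (Fin d)) - z‖)
        ⟨0, Set.forall_mem_range.2 fun _ => norm_nonneg _⟩ ⟨u, hu⟩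
    rw [zero_sub, zero_sub, norm_neg, norm_neg] at hle
    gcongr
  have hspec : IsMaxMargin x y (maxMargin x y) := Classical.epsilon_spec hex
  refine ⟨fun hw => ?_, fun hw => hw ▸ hspec⟩
  have hmid := hconv hw.1 hspec.1 (by norm_num : (0 : ℝ) ≤ 1 / 2) (by norm_num : (0 : ℝ) ≤ 1 / 2)
    (by norm_num)
  have h1 := hw.2 _ hmid
  have h2 := hw.2 _ hspec.1
  have h3 := hspec.2 _ hw.1
  have h4 := parallelogram_law_with_norm ℝ w (maxMargin x y)
  rw [← smul_add, norm_smul, Real.norm_of_nonneg (by norm_num)] at h1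
  have h5 : ‖w - maxMargin x y‖ = 0 := by
    have : ‖w - maxMargin x y‖ ^ 2 ≤ 0 := by nlinarith
    exact pow_eq_zero_iff (two_ne_zero) |>.1 (le_antisymm this (sq_nonneg _))
  exact sub_eq_zero.1 (norm_eq_zero.1 h5)

/-- The normalized margin of the data point `i` with respect to the max-margin solution. -/
def normalizedMargin (x : Fin N → EuclideanSpace ℝ (Fin d)) (y : Fin N → ℝ) (i : Fin N) : ℝ :=
  y i * inner ℝ (x i) (maxMargin x y) / ‖maxMargin x y‖

/-- The maximum margin `φ`. -/
def margin (x : Fin N → EuclideanSpace ℝ (Fin d)) (y : Fin N → ℝ) : ℝ :=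
  ⨅ i, normalizedMargin x y i

open Classical in
/-- The index set `S` of the support vectors: the data points that attain the maximum margin. -/
def supportSet (x : Fin N → EuclideanSpace ℝ (Fin d)) (y : Fin N → ℝ) : Finset (Fin N) :=
  Finset.univ.filter fun i => normalizedMargin x y i = margin x y

/-- `α` represents the max-margin solution as `∑ i ∈ S, αᵢ yᵢ xᵢ` with `αᵢ > 0` on `S`
(and, so that `α` is determined by its values on `S`, `αᵢ = 0` off `S`). -/
def IsDual (x : Fin N → EuclideanSpace ℝ (Fin d)) (y : Fin N → ℝ) (α : Fin N → ℝ) : Prop :=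
  (∀ i ∈ supportSet x y, 0 < α i) ∧ (∀ i ∉ supportSet x y, α i = 0) ∧
    maxMargin x y = ∑ i ∈ supportSet x y, α i • y i • x i

/-- Non-degeneracy of the support vectors. -/
def NonDegenerate (x : Fin N → EuclideanSpace ℝ (Fin d)) (y : Fin N → ℝ) : Prop :=
  ∃! α : Fin N → ℝ, IsDual x y α

/-- The loss is positive, `β`-smooth, decreasing to zero with everywhere negative derivative, and
`limsup_{u → -∞} ℓ'(u) < 0` (taken in the extended reals). -/
structure LossShape (ℓ : ℝ → ℝ) (β : ℝ) : Prop where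
  pos : ∀ u, 0 < ℓ u
  differentiable : Differentiable ℝ ℓ
  smooth : ∀ u v, |deriv ℓ u - deriv ℓ v| ≤ β * |u - v|
  deriv_neg : ∀ u, deriv ℓ u < 0
  tendsto_zero : Tendsto ℓ atTop (𝓝 0)
  limsup_neg : limsup (fun u : ℝ => ((deriv ℓ u : ℝ) : EReal)) atBot < 0

/-- The negative loss derivative has a tight exponential tail. -/
def TightExpTail (ℓ : ℝ → ℝ) : Prop :=
  ∃ μp μm ubar : ℝ, 0 < μp ∧ 0 < μm ∧ 0 < ubar ∧ ∀ u > ubar,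
    (1 - Real.exp (-μm * u)) * Real.exp (-u) ≤ -deriv ℓ u ∧
      -deriv ℓ u ≤ (1 + Real.exp (-μp * u)) * Real.exp (-u)

/-- The space spanned by the support vectors. -/
def supportSpan (x : Fin N → EuclideanSpace ℝ (Fin d)) (y : Fin N → ℝ) :
    Submodule ℝ (EuclideanSpace ℝ (Fin d)) :=
  Submodule.span ℝ (x '' (supportSet x y : Set (Fin N)))

/-- The system of equations for the limit of the residual: `η exp (-yᵢ xᵢᵀ v) = αᵢ` for every
support vector, and `(1 - P) (v - w₀) = 0`, where `P` is the orthogonal projection onto the span of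
the support vectors. -/
def IsResidualLimit (η : ℝ) (x : Fin N → EuclideanSpace ℝ (Fin d)) (y : Fin N → ℝ)
    (α : Fin N → ℝ) (w₀ v : EuclideanSpace ℝ (Fin d)) : Prop :=
  (∀ i ∈ supportSet x y, η * Real.exp (-(y i * inner ℝ (x i) v)) = α i) ∧
    (v - w₀) - (supportSpan x y).starProjection (v - w₀) = 0

end

end ContinualGD

/-! Write $z_i=y_ix_i$, $v=\hat w$, $g=-\ell'$, $b=\ln(K/M)v+\tilde w$, and follow $V_t=\|w_t-(\ln
t)v-b\|^2$ at the starts $w_t$ of the stages. For $i\in S$ let $\delta_i=\langle z_i,w_t\rangle-\ln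
t-\langle z_i,b\rangle$.

Two effects compete in one stage. The gradient steps change $V_t$, in the mean over the tasks and to
leading order near the target, by $\sum_{i\in S}2\alpha_i\delta_ie^{-\delta_i}/t$, because $b$
satisfies $K\frac{\eta}{M}e^{-\langle z_i,b\rangle}=\alpha_i$. Moving the target by about $v/t$
changes it by $-\sum_{i\in S}2\alpha_i\delta_i/t$, because $v=\sum_{i\in S}\alpha_iz_i$. The total
$-2\sum_{i\in S}\alpha_i\delta_i(1-e^{-\delta_i})/t$ is negative unless all $\delta_i$ vanish. Since
$w_t-b$ stays in the span of the support vectors, that happens only at the target. Tail errors,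
motion within the stage, squared steps and the data with margin above 1 cost only
$O(t^{-1-\varepsilon})$. Far below the target the exponential tail is unavailable, and
$\eta\sigma_{\max}^2\beta<2$ keeps the steps from overshooting.

The outcome is `StageSetup.exists_drift`: $E[V_{t+1}\mid\text{past}]\le
V_t+Ct^{-1-\varepsilon}-t^{-1}\min(1,cV_t)$. By a Robbins–Siegmund argument,
`ae_tendsto_zero_of_setIntegral_drift`, $V_t$ converges almost surely, and $\sum 1/t=\infty$ forces
the limit to be zero. The iterates inside a stage follow because the steps tend to zero
(`StageSetup.tendsto_iterate`). The equations for $\tilde w$ are linear after taking logarithms and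
are solved in `exists_isResidualLimit_iff`. -/

namespace ContinualGD

/-! ### Estimates for the gain of a single data point. -/

/-- A positive `β`-Lipschitz function which is bounded away from zero on left half-lines and which
equals `exp (-u)` up to a relative error `exp (-μ u)` for `u > U`. -/
structure ExpTailRate (g : ℝ → ℝ) (β μ U : ℝ) : Prop where
  pos : ∀ u, 0 < g u
  lip : ∀ u v, |g u - g v| ≤ β * |u - v|
  lower : ∀ B, ∃ κ > 0, ∀ u ≤ B, κ ≤ g u
  rate_pos : 0 < μ
  rate_le : μ ≤ 1
  tail : ∀ u > U, |g u - Real.exp (-u)| ≤ Real.exp (-((1 + μ) * u))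

/-- The increase, up to a factor `η`, of the squared distance to the moving target that is caused by
one data point with margin `u`; here `θ * L + b` is the margin of the target. -/
def gain (g : ℝ → ℝ) (s θ b L u : ℝ) : ℝ :=
  2 * g u * (u - θ * L - b) + s * g u ^ 2

namespace ExpTailRate

variable {g : ℝ → ℝ} {β μ U : ℝ}

lemma exists_tail_bounds (h : ExpTailRate g β μ U) {s : ℝ} (hs : 0 ≤ s) :
    ∃ U₀, ∀ u > U₀, Real.exp (-u) / 2 ≤ g u ∧ g u ≤ 2 * Real.exp (-u) ∧ s * g u ≤ 1 := by
  have h1 : Tendsto (fun u : ℝ => Real.exp (-(μ * u))) atTop (𝓝 0) :=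
    Real.tendsto_exp_neg_atTop_nhds_zero.comp (tendsto_id.const_mul_atTop h.rate_pos)
  have h2 : Tendsto (fun u : ℝ => s * (2 * Real.exp (-u))) atTop (𝓝 0) := by
    simpa using (Real.tendsto_exp_neg_atTop_nhds_zero.const_mul 2).const_mul s
  have h3 := ((h1.eventually_le_const (by norm_num : (0 : ℝ) < 1 / 2)).and
    (h2.eventually_le_const (by norm_num : (0 : ℝ) < 1))).and (eventually_ge_atTop U)
  obtain ⟨U₀, hU₀⟩ := eventually_atTop.1 h3
  refine ⟨U₀, fun u hu => ?_⟩
  obtain ⟨⟨h4, h5⟩, -⟩ := hU₀ u hu.le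
  have h6 := h.tail u (lt_of_le_of_lt (hU₀ U₀ le_rfl).2 hu)
  have h7 : Real.exp (-((1 + μ) * u)) = Real.exp (-u) * Real.exp (-(μ * u)) := by
    rw [← Real.exp_add]; ring_nf
  rw [h7, abs_le] at h6
  have h8 := Real.exp_pos (-u)
  have h9 : g u ≤ 2 * Real.exp (-u) := by nlinarith
  exact ⟨by nlinarith, h9, (mul_le_mul_of_nonneg_left h9 hs).trans h5⟩

/-- Below the tail only the Lipschitz growth of `g` is available, so `s * g u ^ 2` may grow as fast
as `g u` times the distance to the target. The step-size condition `s * β < 2` lets the linear term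
win with the factor `1 - s * β / 2` to spare. -/
lemma exists_low_bound (h : ExpTailRate g β μ U) {s : ℝ} (hs : 0 ≤ s) (hsβ : s * β < 2)
    {θ : ℝ} (hθ : 1 ≤ θ) (b U₀ : ℝ) :
    ∃ L₀, ∀ L ≥ L₀, ∀ u ≤ U₀, u - θ * L - b < 0 ∧
      gain g s θ b L u ≤ g u * ((1 - s * β / 2) * (u - θ * L - b)) := by
  set c := 1 - s * β / 2 with hc
  have hc0 : 0 < c := by rw [hc]; linarith
  have hβ : 0 ≤ β := by
    have := h.lip 1 0
    norm_num at this
    exact (abs_nonneg _).trans this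
  set C := s * g U₀ + s * β * |U₀ - b| with hC
  have hC0 : 0 ≤ C := by have := h.pos U₀; positivity
  -- With `δ = u - θ * L - b`, the Lipschitz bound gives `2 * δ + s * g u ≤ C + 2 * c * δ`; such `L`
  -- force `C ≤ -c * δ`.
  refine ⟨|U₀ - b| + C / c + 1, fun L hL u hu => ?_⟩
  have hq : 0 ≤ C / c := by positivity
  have hL0 : 0 ≤ L := by have := abs_nonneg (U₀ - b); linarith
  have hL1 : L ≤ θ * L := by nlinarith
  have hδ : u - θ * L - b ≤ -(C / c) - 1 := by
    have := le_abs_self (U₀ - b); linarith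
  refine ⟨by linarith, ?_⟩
  set δ := u - θ * L - b with hδd
  have hg : g u ≤ g U₀ + β * (U₀ - u) := by
    have h1 := h.lip u U₀
    rw [abs_sub_comm u U₀, abs_of_nonneg (by linarith : 0 ≤ U₀ - u)] at h1
    have := le_abs_self (g u - g U₀)
    linarith
  have h2 : U₀ - u ≤ |U₀ - b| - δ := by
    have := le_abs_self (U₀ - b); rw [hδd]; linarith
  have h3 : s * g u ≤ C - s * β * δ := by
    have h4 : s * g u ≤ s * (g U₀ + β * (|U₀ - b| - δ)) :=
      mul_le_mul_of_nonneg_left (hg.trans (by gcongr)) hs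
    rw [hC]; linarith
  have h5 : C + c * δ ≤ 0 := by
    have : c * (C / c) = C := by field_simp
    nlinarith
  have h6 : gain g s θ b L u = g u * (2 * δ + s * g u) := by
    rw [gain, hδd]; ring
  rw [h6]
  refine mul_le_mul_of_nonneg_left ?_ (h.pos u).le
  have : s * β = 2 - 2 * c := by rw [hc]; ring
  rw [this] at h3
  linarith

lemma gain_le_of_tail {s θ b L u : ℝ} (hg : 0 < g u) (h3 : s * g u ≤ 1) :
    gain g s θ b L u ≤ 2 * g u * (u - θ * L - b + 1 / 2) := by
  rw [gain]
  nlinarith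

/-- The gain is at most of the order of the loss of the target. -/
lemma exists_gain_le (h : ExpTailRate g β μ U) {s : ℝ} (hs : 0 ≤ s) (hsβ : s * β < 2)
    {θ : ℝ} (hθ : 1 ≤ θ) (b : ℝ) :
    ∃ C L₀, 0 ≤ C ∧ ∀ L ≥ L₀, ∀ u, gain g s θ b L u ≤ C * Real.exp (-(θ * L)) := by
  obtain ⟨U₀, hU₀⟩ := h.exists_tail_bounds hs
  obtain ⟨L₀, hL₀⟩ := h.exists_low_bound hs hsβ hθ b U₀
  refine ⟨4 * Real.exp (-b), L₀, by positivity, fun L hL u => ?_⟩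
  rcases le_or_gt u U₀ with hu | hu
  · obtain ⟨h1, h2⟩ := hL₀ L hL u hu
    have h3 : g u * ((1 - s * β / 2) * (u - θ * L - b)) ≤ 0 :=
      mul_nonpos_of_nonneg_of_nonpos (h.pos u).le
        (mul_nonpos_of_nonneg_of_nonpos (by linarith) h1.le)
    exact (h2.trans h3).trans (by positivity)
  · obtain ⟨-, h2, h3⟩ := hU₀ u hu
    refine (gain_le_of_tail (h.pos u) h3).trans ?_
    set δ := u - θ * L - b with hδ
    have hexp : Real.exp (-u) = Real.exp (-b) * Real.exp (-(θ * L)) * Real.exp (-δ) := by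
      rw [← Real.exp_add, ← Real.exp_add, hδ]; ring_nf
    -- The factor `exp δ` cancels the `exp (-δ)` in `exp (-u)`, so the bound no longer depends on
    -- `u`.
    have hd : (δ + 1 / 2) ≤ Real.exp δ := by linarith [Real.add_one_le_exp δ]
    have hδ1 : Real.exp (-δ) * Real.exp δ = 1 := by rw [← Real.exp_add]; simp
    rcases le_or_gt (δ + 1 / 2) 0 with h4 | h4
    · exact (mul_nonpos_of_nonneg_of_nonpos (by linarith [h.pos u]) h4).trans (by positivity)
    · calc 2 * g u * (δ + 1 / 2) ≤ 2 * (2 * Real.exp (-u)) * Real.exp δ := by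
            have := (h.pos u).le
            gcongr
        _ = 4 * Real.exp (-b) * Real.exp (-(θ * L)) * (Real.exp (-δ) * Real.exp δ) := by
            rw [hexp]; ring
        _ = _ := by rw [hδ1, mul_one]

/-- A margin far below the target has a strongly negative gain. -/
lemma exists_gain_le_of_le_neg (h : ExpTailRate g β μ U) {s : ℝ} (hs : 0 ≤ s) (hsβ : s * β < 2)
    (b : ℝ) {A : ℝ} (hA : 0 < A) :
    ∃ R L₀, 0 ≤ R ∧ ∀ L ≥ L₀, ∀ u, u - L - b ≤ -R →
      gain g s 1 b L u ≤ A * (u - L - b) * Real.exp (-L) := by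
  obtain ⟨U₀, hU₀⟩ := h.exists_tail_bounds hs
  obtain ⟨L₀, hL₀⟩ := h.exists_low_bound hs hsβ le_rfl b U₀
  obtain ⟨κ, hκ, hκg⟩ := h.lower U₀
  have hc0 : 0 < 1 - s * β / 2 := by linarith
  have h1 : Tendsto (fun L : ℝ => A * Real.exp (-L)) atTop (𝓝 0) := by
    simpa using Real.tendsto_exp_neg_atTop_nhds_zero.const_mul A
  obtain ⟨L₁, hL₁⟩ := eventually_atTop.1
    (h1.eventually_le_const (mul_pos hκ hc0))
  -- The bound `δ ≤ -1` absorbs the summand `1 / 2` of `gain_le_of_tail`; the logarithm makes `exp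
  -- (-u) = exp (-L - b - δ)` at least `2 * A * exp (-L)`.
  refine ⟨max 1 (Real.log (2 * A * Real.exp b)), max L₀ L₁, le_max_of_le_left zero_le_one,
    fun L hL u hu => ?_⟩
  rcases le_or_gt u U₀ with hu0 | hu0
  · obtain ⟨h2, h3⟩ := hL₀ L (le_of_max_le_left hL) u hu0
    rw [one_mul] at h2 h3
    have h4 := hL₁ L (le_of_max_le_right hL)
    have h5 : κ * (1 - s * β / 2) ≤ g u * (1 - s * β / 2) :=
      mul_le_mul_of_nonneg_right (hκg u hu0) hc0.le
    nlinarith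
  · obtain ⟨h2, h2', h3⟩ := hU₀ u hu0
    refine (gain_le_of_tail (h.pos u) h3).trans ?_
    rw [one_mul]
    set δ := u - L - b with hδ
    have h4 : δ ≤ -1 := hu.trans (neg_le_neg (le_max_left _ _))
    have h5 : Real.log (2 * A * Real.exp b) ≤ -δ := by
      have := le_max_right 1 (Real.log (2 * A * Real.exp b)); linarith
    have h6 : 2 * A * Real.exp b ≤ Real.exp (-δ) := by
      rwa [Real.log_le_iff_le_exp (by positivity)] at h5
    have hexp : Real.exp (-u) * Real.exp b = Real.exp (-L) * Real.exp (-δ) := by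
      rw [← Real.exp_add, ← Real.exp_add, hδ]; ring_nf
    have h7 : 2 * A * Real.exp (-L) ≤ Real.exp (-u) := by
      have h8 : 2 * A * Real.exp (-L) * Real.exp b ≤ Real.exp (-u) * Real.exp b := by
        rw [hexp]; nlinarith [Real.exp_pos (-L)]
      exact le_of_mul_le_mul_right h8 (Real.exp_pos b)
    have h9 : A * Real.exp (-L) ≤ g u := by linarith
    have := h.pos u
    nlinarith

/-- The gain close to the target, up to terms of higher order. -/
lemma exists_gain_le_of_abs_le (h : ExpTailRate g β μ U) {s : ℝ} (hs : 0 ≤ s) (b R D : ℝ)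
    (hR : 0 ≤ R) (hD : 0 ≤ D) :
    ∃ C L₀, 0 ≤ C ∧ ∀ L ≥ L₀, ∀ u v, |u - L - b| ≤ R → |v - u| ≤ D * Real.exp (-L) →
      gain g s 1 b L v ≤ 2 * Real.exp (-b) * ((u - L - b) * Real.exp (-(u - L - b))) * Real.exp (-L)
        + C * Real.exp (-((1 + μ) * L)) := by
  have hμ := h.rate_pos
  set c := R + D - b with hc
  set C₁ := Real.exp ((1 + μ) * c) with hC₁
  set C₂ := Real.exp c with hC₂
  have hC₁0 : 0 < C₁ := Real.exp_pos _
  have hC₂0 : 0 < C₂ := Real.exp_pos _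
  -- The summands bound, in order, the error of replacing `g v` by `exp (-u)`, the shift from `u` to
  -- `v` in the linear factor, and the squared term. Since `μ ≤ 1`, errors of order `exp (-2 * L)`
  -- are also of order `exp (-((1 + μ) * L))`.
  refine ⟨2 * (C₁ + C₂ * D) * R + 2 * (C₁ + C₂) * D + s * (C₁ + C₂) ^ 2, max 0 (U + c + 1),
    by positivity, fun L hL u v hu hv => ?_⟩
  have hL0 : 0 ≤ L := le_of_max_le_left hL
  have hLU : U + c + 1 ≤ L := le_of_max_le_right hL
  set e := Real.exp (-L) with he
  set q := Real.exp (-((1 + μ) * L)) with hq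
  have he0 : 0 < e := Real.exp_pos _
  have hq0 : 0 < q := Real.exp_pos _
  have he1 : e ≤ 1 := Real.exp_le_one_iff.2 (by linarith)
  have hqe : q ≤ e := Real.exp_le_exp.2 (by nlinarith)
  have heq : e ^ 2 ≤ q := by
    rw [he, hq, ← Real.exp_nat_mul]
    refine Real.exp_le_exp.2 ?_
    have := h.rate_le
    push_cast
    nlinarith
  have hDe : D * e ≤ D := by nlinarith
  obtain ⟨hu1, hu2⟩ := abs_le.1 hu
  obtain ⟨hv1, hv2⟩ := abs_le.1 hv
  have hvL : L - c ≤ v := by rw [hc]; linarith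
  have huL : L - c ≤ u := by rw [hc]; linarith
  have hLc : Real.exp (-(L - c)) = C₂ * e := by rw [hC₂, he, ← Real.exp_add]; ring_nf
  have ht : |g v - Real.exp (-v)| ≤ C₁ * q := by
    refine (h.tail v (by linarith)).trans ?_
    rw [hC₁, hq, ← Real.exp_add]
    exact Real.exp_le_exp.2 (by nlinarith)
  have hlip : |Real.exp (-v) - Real.exp (-u)| ≤ C₂ * D * q := by
    have hvu : |v - u| * (C₂ * e) ≤ C₂ * D * q := by
      calc |v - u| * (C₂ * e) ≤ D * e * (C₂ * e) := by gcongr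
        _ = C₂ * D * e ^ 2 := by ring
        _ ≤ _ := by gcongr
    refine le_trans ?_ hvu
    have hev : Real.exp (-v) ≤ C₂ * e := hLc ▸ Real.exp_le_exp.2 (by linarith)
    have heu : Real.exp (-u) ≤ C₂ * e := hLc ▸ Real.exp_le_exp.2 (by linarith)
    have key : ∀ p r : ℝ, Real.exp (-p) - Real.exp (-r) ≤ |p - r| * Real.exp (-p) := by
      intro p r
      have h1 := Real.add_one_le_exp (p - r)
      have h2 : Real.exp (-r) = Real.exp (-p) * Real.exp (p - r) := by
        rw [← Real.exp_add]; ring_nf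
      have h3 := neg_abs_le (p - r)
      have := Real.exp_pos (-p)
      rw [h2]
      nlinarith
    rw [abs_le]
    have k1 := key v u
    have k2 := key u v
    rw [abs_sub_comm u v] at k2
    have k3 := mul_le_mul_of_nonneg_left hev (abs_nonneg (v - u))
    have k4 := mul_le_mul_of_nonneg_left heu (abs_nonneg (v - u))
    constructor <;> linarith
  have hgu : |g v - Real.exp (-u)| ≤ (C₁ + C₂ * D) * q := by
    have := abs_sub_le (g v) (Real.exp (-v)) (Real.exp (-u))
    linarith
  have hgv : g v ≤ (C₁ + C₂) * e := by
    have hev : Real.exp (-v) ≤ C₂ * e := hLc ▸ Real.exp_le_exp.2 (by linarith)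
    have h1 := (abs_le.1 ht).2
    have h2 : C₁ * q ≤ C₁ * e := by gcongr
    linarith
  have hg0 := (h.pos v).le
  have hmain : Real.exp (-u) = Real.exp (-b) * Real.exp (-(u - L - b)) * e := by
    rw [he, ← Real.exp_add, ← Real.exp_add]; ring_nf
  have h1 : (g v - Real.exp (-u)) * (u - L - b) ≤ (C₁ + C₂ * D) * q * R := by
    refine (le_abs_self _).trans ?_
    rw [abs_mul]
    gcongr
  have h2 : g v * (v - u) ≤ (C₁ + C₂) * D * q := by
    calc g v * (v - u) ≤ (C₁ + C₂) * e * (D * e) :=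
          (mul_le_mul_of_nonneg_left hv2 hg0).trans (by gcongr)
      _ = (C₁ + C₂) * D * e ^ 2 := by ring
      _ ≤ _ := by gcongr
  have h3 : s * g v ^ 2 ≤ s * (C₁ + C₂) ^ 2 * q := by
    calc s * g v ^ 2 ≤ s * ((C₁ + C₂) * e) ^ 2 := by gcongr
      _ = s * (C₁ + C₂) ^ 2 * e ^ 2 := by ring
      _ ≤ _ := by gcongr
  have h4 : gain g s 1 b L v = 2 * (Real.exp (-u) * (u - L - b)) +
      2 * ((g v - Real.exp (-u)) * (u - L - b)) + 2 * (g v * (v - u)) + s * g v ^ 2 := by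
    rw [gain]; ring
  rw [h4, hmain]
  rw [hmain] at h1
  linarith

end ExpTailRate

/-! ### Gradient steps and the squared distance to a moving target. -/

section Drift

variable {E ι : Type*} [NormedAddCommGroup E] [InnerProductSpace ℝ E]

/-- A gradient step on the data `z i`, `i ∈ J`, in terms of the negative loss derivative `g`. -/
def marginStep (g : ℝ → ℝ) (η : ℝ) (z : ι → E) (J : Finset ι) (w : E) : E :=
  w + η • ∑ i ∈ J, g (inner ℝ (z i) w) • z i

variable {g : ℝ → ℝ} {β μ U η s : ℝ} {z : ι → E} {J : Finset ι}

lemma marginStep_sub_mem {W : Submodule ℝ E} (hz : ∀ i, z i ∈ W) (w : E) :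
    marginStep g η z J w - w ∈ W := by
  rw [marginStep, add_sub_cancel_left]
  exact W.smul_mem _ (W.sum_mem fun i _ => W.smul_mem _ (hz i))

/-- Keeps the error in the span of the support vectors, where its norm is controlled by the margins.
-/
lemma iterate_marginStep_sub_mem {W : Submodule ℝ E} (hz : ∀ i, z i ∈ W) (w : E) (k : ℕ) :
    (marginStep g η z J)^[k] w - w ∈ W := by
  induction k with
  | zero => simp
  | succ k ih =>
    rw [Function.iterate_succ_apply']
    have := W.add_mem (marginStep_sub_mem (g := g) (η := η) (J := J) hz
      ((marginStep g η z J)^[k] w)) ih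
    rwa [sub_add_sub_cancel] at this

/-- Allows the cross term with the shift of the target to be evaluated at the start of the stage,
before the task acts. -/
lemma inner_le_inner_iterate_marginStep (hg : ∀ u, 0 ≤ g u) (hη : 0 ≤ η) {v : E}
    (hv : ∀ i, 0 ≤ (inner ℝ (z i) v : ℝ)) (w : E) (k : ℕ) :
    (inner ℝ v w : ℝ) ≤ inner ℝ v ((marginStep g η z J)^[k] w) := by
  induction k with
  | zero => simp
  | succ k ih =>
    rw [Function.iterate_succ_apply', marginStep, inner_add_right, inner_smul_right, inner_sum]
    have : 0 ≤ ∑ i ∈ J, (inner ℝ v (g (inner ℝ (z i) ((marginStep g η z J)^[k] w)) • z i) : ℝ) := by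
      refine Finset.sum_nonneg fun i _ => ?_
      rw [inner_smul_right, real_inner_comm (z i) v]
      exact mul_nonneg (hg _) (hv i)
    have := mul_nonneg hη this
    linarith

/-- The squared distance of the iterates to a moving target `L • v + b`. -/
lemma norm_iterate_marginStep_sq_le (hη : 0 ≤ η)
    (hs : ∀ c : ι → ℝ, η * ‖∑ i ∈ J, c i • z i‖ ^ 2 ≤ s * ∑ i ∈ J, c i ^ 2)
    (v b : E) (L : ℝ) (w : E) (k : ℕ) :
    ‖(marginStep g η z J)^[k] w - L • v - b‖ ^ 2 ≤ ‖w - L • v - b‖ ^ 2 +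
      η * ∑ k' ∈ Finset.range k, ∑ i ∈ J, gain g s (inner ℝ (z i) v) (inner ℝ (z i) b) L
        (inner ℝ (z i) ((marginStep g η z J)^[k'] w)) := by
  induction k with
  | zero => simp
  | succ k ih =>
    rw [Function.iterate_succ_apply', Finset.sum_range_succ, mul_add, ← add_assoc]
    refine le_trans ?_ (add_le_add_left ih _)
    set w' := (marginStep g η z J)^[k] w with hw'
    have h1 : marginStep g η z J w' - L • v - b =
        (w' - L • v - b) + η • ∑ i ∈ J, g (inner ℝ (z i) w') • z i := by
      rw [marginStep]; abel
    rw [h1, norm_add_sq_real, inner_smul_right, norm_smul, mul_pow, Real.norm_eq_abs, sq_abs,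
      inner_sum]
    have h2 := mul_le_mul_of_nonneg_left (hs fun i => g (inner ℝ (z i) w')) hη
    have h3 : ∑ i ∈ J, gain g s (inner ℝ (z i) v) (inner ℝ (z i) b) L (inner ℝ (z i) w') =
        2 * (∑ i ∈ J, (inner ℝ (w' - L • v - b) (g (inner ℝ (z i) w') • z i) : ℝ)) +
          s * ∑ i ∈ J, g (inner ℝ (z i) w') ^ 2 := by
      rw [Finset.mul_sum, Finset.mul_sum, ← Finset.sum_add_distrib]
      refine Finset.sum_congr rfl fun i _ => ?_
      rw [gain, inner_smul_right, real_inner_comm (z i) (w' - L • v - b), inner_sub_right, inner_sub_right,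
        inner_smul_right]
      ring
    rw [h3]
    linarith

/-- The squared distance to the target over one stage, during which the target moves by `lam • v`. -/
lemma norm_stage_sq_le (hg : ∀ u, 0 ≤ g u) (hη : 0 ≤ η)
    (hs : ∀ c : ι → ℝ, η * ‖∑ i ∈ J, c i • z i‖ ^ 2 ≤ s * ∑ i ∈ J, c i ^ 2)
    {v : E} (hv : ∀ i, 0 ≤ (inner ℝ (z i) v : ℝ)) (b : E) (L : ℝ) {lam : ℝ} (hl : 0 ≤ lam)
    (w : E) (k : ℕ) :
    ‖(marginStep g η z J)^[k] w - (L + lam) • v - b‖ ^ 2 ≤ ‖w - L • v - b‖ ^ 2 +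
      η * ∑ k' ∈ Finset.range k, ∑ i ∈ J, gain g s (inner ℝ (z i) v) (inner ℝ (z i) b) L
        (inner ℝ (z i) ((marginStep g η z J)^[k'] w)) -
      2 * lam * inner ℝ v (w - L • v - b) + lam ^ 2 * ‖v‖ ^ 2 := by
  have h1 := norm_iterate_marginStep_sq_le (g := g) hη hs v b L w k
  have h2 := inner_le_inner_iterate_marginStep (J := J) hg hη hv w k
  set w' := (marginStep g η z J)^[k] w
  have h3 : w' - (L + lam) • v - b = (w' - L • v - b) - lam • v := by rw [add_smul]; abel
  rw [h3, norm_sub_sq_real, inner_smul_right, norm_smul, mul_pow, Real.norm_eq_abs, sq_abs,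
    real_inner_comm]
  have h4 : (inner ℝ v (w - L • v - b) : ℝ) ≤ inner ℝ v (w' - L • v - b) := by
    simp only [inner_sub_right]; linarith
  have h5 := mul_le_mul_of_nonneg_left h4 hl
  linarith

/-- If all margins are close to `L` or larger, then the iterates within a stage barely move. -/
lemma exists_norm_iterate_marginStep_sub_le [Fintype ι] (h : ExpTailRate g β μ U) (hη : 0 ≤ η)
    (z : ι → E) (c : ℝ) (K : ℕ) :
    ∃ D L₀, 0 ≤ D ∧ ∀ L ≥ L₀, ∀ w : E, (∀ i, L - c ≤ inner ℝ (z i) w) → ∀ J : Finset ι, ∀ k ≤ K,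
      ‖(marginStep g η z J)^[k] w - w‖ ≤ D * Real.exp (-L) := by
  obtain ⟨U₀, hU₀⟩ := h.exists_tail_bounds le_rfl
  set Z := ∑ i, ‖z i‖ with hZ
  have hZ0 : 0 ≤ Z := by positivity
  induction K with
  | zero => exact ⟨0, 0, le_rfl, fun L _ w _ J k hk => by simp [Nat.le_zero.1 hk]⟩
  | succ K ih =>
    obtain ⟨D, L₀, hD, hDL⟩ := ih
    have h1 : Tendsto (fun L : ℝ => Z * (D * Real.exp (-L))) atTop (𝓝 0) := by
      simpa using (Real.tendsto_exp_neg_atTop_nhds_zero.const_mul D).const_mul Z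
    obtain ⟨L₁, hL₁⟩ := eventually_atTop.1 (h1.eventually_le_const (zero_lt_one' ℝ))
    have hD' : 0 ≤ η * (2 * Real.exp (c + 1) * Z) := by positivity
    -- The threshold `L₁` limits the loss of margin in the first `K` steps to 1; `U₀ + c + 2` then
    -- keeps all margins in the tail for the next step.
    refine ⟨D + η * (2 * Real.exp (c + 1) * Z), max L₀ (max L₁ (U₀ + c + 2)), by positivity,
      fun L hL w hw J k hk => ?_⟩
    have hLa := le_of_max_le_left hL
    have hLb := le_of_max_le_left (le_of_max_le_right hL)
    have hLc := le_of_max_le_right (le_of_max_le_right hL)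
    rcases Nat.lt_or_ge k (K + 1) with hk' | hk'
    · refine (hDL L hLa w hw J k (Nat.lt_succ_iff.1 hk')).trans ?_
      gcongr
      linarith
    · obtain rfl : k = K + 1 := le_antisymm hk hk'
      have h2 := hDL L hLa w hw J K le_rfl
      rw [Function.iterate_succ_apply']
      set w' := (marginStep g η z J)^[K] w
      have hi : ∀ i, ‖z i‖ ≤ Z := fun i =>
        Finset.single_le_sum (f := fun i => ‖z i‖) (fun _ _ => norm_nonneg _) (Finset.mem_univ i)
      have hm : ∀ i, L - c - 1 ≤ inner ℝ (z i) w' := fun i => by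
        have h3 : (inner ℝ (z i) w' : ℝ) = inner ℝ (z i) w + inner ℝ (z i) (w' - w) := by
          rw [inner_sub_right]; ring
        have h4 := (abs_le.1 (abs_real_inner_le_norm (z i) (w' - w))).1
        have h5 : ‖z i‖ * ‖w' - w‖ ≤ Z * (D * Real.exp (-L)) :=
          mul_le_mul (hi i) h2 (norm_nonneg _) hZ0
        have := hw i
        have := hL₁ L hLb
        linarith
      have hgi : ∀ i, g (inner ℝ (z i) w') ≤ 2 * Real.exp (c + 1) * Real.exp (-L) := fun i => by
        have h3 := hm i
        refine (hU₀ _ (by linarith)).2.1.trans ?_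
        rw [mul_assoc, ← Real.exp_add]
        have : Real.exp (-inner ℝ (z i) w') ≤ Real.exp (c + 1 + -L) :=
          Real.exp_le_exp.2 (by linarith)
        linarith
      have h6 : ‖marginStep g η z J w' - w'‖ ≤ η * (2 * Real.exp (c + 1) * Z) * Real.exp (-L) := by
        rw [marginStep, add_sub_cancel_left, norm_smul, Real.norm_of_nonneg hη, mul_assoc]
        refine mul_le_mul_of_nonneg_left ?_ hη
        calc ‖∑ i ∈ J, g (inner ℝ (z i) w') • z i‖
            ≤ ∑ i ∈ J, 2 * Real.exp (c + 1) * Real.exp (-L) * ‖z i‖ := by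
              refine norm_sum_le_of_le _ fun i _ => ?_
              rw [norm_smul, Real.norm_of_nonneg (h.pos _).le]
              exact mul_le_mul_of_nonneg_right (hgi i) (norm_nonneg _)
          _ ≤ ∑ i, 2 * Real.exp (c + 1) * Real.exp (-L) * ‖z i‖ :=
              Finset.sum_le_sum_of_subset_of_nonneg (Finset.subset_univ _)
                fun _ _ _ => by positivity
          _ = _ := by rw [← Finset.mul_sum]; ring
      have h7 := norm_sub_le_norm_sub_add_norm_sub (marginStep g η z J w') w' w
      linarith

end Drift

/-! ### Contribution of one data point to the drift over a stage. -/

namespace ExpTailRate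

variable {g : ℝ → ℝ} {β μ U s : ℝ}

/-- The contribution of a support vector to the drift, far from the target. -/
lemma exists_drift_le_sub_abs (h : ExpTailRate g β μ U) (hs : 0 ≤ s) (hsβ : s * β < 2) (b : ℝ)
    {κ a : ℝ} (hκ : 0 < κ) (ha : 0 < a) {K : ℕ} (hK : 1 ≤ K) :
    ∃ C, ∀ᶠ L in atTop, ∀ lam, Real.exp (-L) - Real.exp (-L) ^ 2 ≤ lam → lam ≤ Real.exp (-L) →
      ∀ u : ℕ → ℝ, κ * ∑ k ∈ Finset.range K, gain g s 1 b L (u k) - 2 * lam * (a * (u 0 - L - b)) ≤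
        (C - a * |u 0 - L - b|) * Real.exp (-L) := by
  obtain ⟨C, L₀, hC, hC'⟩ := h.exists_gain_le hs hsβ le_rfl b
  -- For negative deviation `δ` the moving target costs up to `2 * a * |δ| * exp (-L)`; a gain with
  -- `A = 3 * a / κ` pays for this and leaves `a * |δ| * exp (-L)`.
  obtain ⟨R, L₁, hR, hR'⟩ := h.exists_gain_le_of_le_neg hs hsβ b (A := 3 * a / κ) (by positivity)
  refine ⟨κ * (K * C) + 3 * a * R, ?_⟩
  filter_upwards [eventually_ge_atTop L₀, eventually_ge_atTop L₁, eventually_ge_atTop 1]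
    with L h0 h1 h2 lam hl1 hl2 u
  set e := Real.exp (-L) with he
  have he0 : 0 < e := Real.exp_pos _
  have he1 : e ≤ 1 / 2 := by
    have h3 := Real.add_one_le_exp L
    have h4 : e * Real.exp L = 1 := by rw [he, ← Real.exp_add]; simp
    nlinarith
  have hl0 : 0 ≤ lam := by nlinarith
  have hg : ∀ k, gain g s 1 b L (u k) ≤ C * e := fun k => by simpa using hC' L h0 (u k)
  have hsum : κ * ∑ k ∈ Finset.range K, gain g s 1 b L (u k) ≤ κ * (K * C) * e := by
    have := Finset.sum_le_card_nsmul (Finset.range K) _ _ fun k _ => hg k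
    rw [Finset.card_range, nsmul_eq_mul] at this
    nlinarith
  have ha3 : 0 ≤ 3 * a * R * e := by positivity
  set δ := u 0 - L - b with hδ
  rcases le_or_gt 0 δ with hd | hd
  · rw [abs_of_nonneg hd]
    -- Above the target it is the motion of the target that produces the decrease.
    have h5 : e / 2 ≤ lam := by nlinarith
    have h6 : 0 ≤ a * δ := by positivity
    nlinarith
  · rw [abs_of_neg hd]
    have h7 : -(2 * lam * (a * δ)) ≤ 2 * e * (a * -δ) := by
      have : 0 ≤ a * -δ := mul_nonneg ha.le (by linarith)
      nlinarith
    rcases le_or_gt δ (-R) with hd2 | hd2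
    · obtain ⟨K, rfl⟩ : ∃ n, K = n + 1 := ⟨K - 1, by omega⟩
      have h8 := hR' L h1 (u 0) hd2
      have h9 := Finset.sum_le_card_nsmul (Finset.range K) _ _ fun k _ => hg (k + 1)
      rw [Finset.card_range, nsmul_eq_mul] at h9
      rw [Finset.sum_range_succ', mul_add]
      have h10 := mul_le_mul_of_nonneg_left h8 hκ.le
      have h11 : κ * (3 * a / κ * (u 0 - L - b) * e) = 3 * a * δ * e := by
        rw [hδ]; field_simp
      have h12 := mul_le_mul_of_nonneg_left h9 hκ.le
      push_cast
      have h13 : 0 ≤ κ * C * e := by positivity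
      rw [h11] at h10
      linarith
    · have : a * -δ * e ≤ a * R * e := by gcongr; linarith
      linarith

/-- The contribution of a support vector to the drift, close to the target. -/
lemma exists_drift_le_sub_sq (h : ExpTailRate g β μ U) (hs : 0 ≤ s) (b : ℝ)
    {κ a : ℝ} (hκ : 0 < κ) (ha : 0 < a) {K : ℕ} (hb : K * (κ * Real.exp (-b)) = a) {R D : ℝ}
    (hR : 0 ≤ R) (hD : 0 ≤ D) :
    ∃ C, ∀ᶠ L in atTop, ∀ lam, Real.exp (-L) - Real.exp (-L) ^ 2 ≤ lam → lam ≤ Real.exp (-L) →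
      ∀ u : ℕ → ℝ, |u 0 - L - b| ≤ R → (∀ k < K, |u k - u 0| ≤ D * Real.exp (-L)) →
      κ * ∑ k ∈ Finset.range K, gain g s 1 b L (u k) - 2 * lam * (a * (u 0 - L - b)) ≤
        -(2 * a / (1 + R) * (u 0 - L - b) ^ 2) * Real.exp (-L) +
          C * Real.exp (-((1 + μ) * L)) := by
  obtain ⟨C, L₀, hC, hC'⟩ := h.exists_gain_le_of_abs_le hs b R D hR hD
  refine ⟨κ * (K * C) + 2 * a * R, ?_⟩
  filter_upwards [eventually_ge_atTop L₀, eventually_ge_atTop 0]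
    with L h0 h2 lam hl1 hl2 u hu hk
  set e := Real.exp (-L) with he
  set q := Real.exp (-((1 + μ) * L)) with hq
  have he0 : 0 < e := Real.exp_pos _
  have heq : e ^ 2 ≤ q := by
    rw [he, hq, ← Real.exp_nat_mul]
    refine Real.exp_le_exp.2 ?_
    have := h.rate_le
    push_cast
    nlinarith
  set δ := u 0 - L - b with hδ
  have hsum : κ * ∑ k ∈ Finset.range K, gain g s 1 b L (u k) ≤
      2 * a * (δ * Real.exp (-δ)) * e + κ * (K * C) * q := by
    have h3 := Finset.sum_le_card_nsmul (Finset.range K) _ _ fun k hk' =>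
      hC' L h0 (u 0) (u k) hu (hk k (Finset.mem_range.1 hk'))
    rw [Finset.card_range, nsmul_eq_mul] at h3
    refine (mul_le_mul_of_nonneg_left h3 hκ.le).trans (le_of_eq ?_)
    rw [← hb]
    ring
  have h4 : -(2 * lam * (a * δ)) ≤ -(2 * a * δ * e) + 2 * a * R * q := by
    have h5 : |(e - lam) * δ| ≤ q * R := by
      rw [abs_mul]
      refine mul_le_mul ?_ hu (abs_nonneg _) (Real.exp_pos _).le
      rw [abs_of_nonneg (by linarith)]
      linarith
    have h6 := mul_le_mul_of_nonneg_left ((le_abs_self _).trans h5) ha.le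
    linarith
  -- The hypothesis `hb` matches the coefficients, so gain and motion combine to `-2 * a * δ * (1 -
  -- exp (-δ)) * e`. This inequality makes that quadratic on `|δ| ≤ R`.
  have h7 : δ ^ 2 / (1 + R) ≤ δ * (1 - Real.exp (-δ)) := by
    rw [div_le_iff₀ (by linarith)]
    rcases le_or_gt 0 δ with hd | hd
    · have h8 : δ ≤ (1 - Real.exp (-δ)) * (1 + R) := by
        have h9 := Real.add_one_le_exp δ
        have h10 : Real.exp (-δ) * Real.exp δ = 1 := by rw [← Real.exp_add]; simp
        have h11 := Real.exp_pos (-δ)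
        have h12 : Real.exp (-δ) ≤ 1 := Real.exp_le_one_iff.2 (by linarith)
        have h13 := (abs_le.1 hu).2
        nlinarith
      nlinarith
    · have h8 := Real.add_one_le_exp (-δ)
      have h9 : δ ^ 2 ≤ δ * (1 - Real.exp (-δ)) := by nlinarith
      have : 0 ≤ δ * (1 - Real.exp (-δ)) := (sq_nonneg _).trans h9
      nlinarith
  have h14 := mul_le_mul_of_nonneg_left h7 (by positivity : 0 ≤ 2 * a * e)
  have h15 : 2 * a * e * (δ ^ 2 / (1 + R)) = 2 * a / (1 + R) * δ ^ 2 * e := by ring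
  linarith

/-- The contribution to the drift of a data point which is not a support vector. -/
lemma exists_drift_le (h : ExpTailRate g β μ U) (hs : 0 ≤ s) (hsβ : s * β < 2)
    {θ : ℝ} (hθ : 1 ≤ θ) (b : ℝ) {κ : ℝ} (hκ : 0 < κ) (K : ℕ) :
    ∃ C, 0 ≤ C ∧ ∀ᶠ L in atTop, ∀ u : ℕ → ℝ,
      κ * ∑ k ∈ Finset.range K, gain g s θ b L (u k) ≤ C * Real.exp (-(θ * L)) := by
  obtain ⟨C, L₀, hC, hC'⟩ := h.exists_gain_le hs hsβ hθ b
  refine ⟨κ * (K * C), by positivity, ?_⟩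
  filter_upwards [eventually_ge_atTop L₀] with L h0 u
  have := Finset.sum_le_card_nsmul (Finset.range K) _ _ fun k _ => hC' L h0 (u k)
  rw [Finset.card_range, nsmul_eq_mul] at this
  linarith [mul_le_mul_of_nonneg_left this hκ.le]

end ExpTailRate

/-! ### The drift inequality for a stage with a uniform task. -/

lemma sum_sum_partition {ι : Type*} [Fintype ι] {M : ℕ} {I : Fin M → Finset ι} {j : ι → Fin M}
    (hj : ∀ i l, i ∈ I l ↔ l = j i) (f : Fin M → ι → ℝ) :
    ∑ l, ∑ i ∈ I l, f l i = ∑ i, f (j i) i := by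
  classical
  have h1 : ∀ l, ∑ i ∈ I l, f l i = ∑ i, if l = j i then f l i else 0 := fun l => by
    rw [← Finset.sum_filter]
    congr 1
    ext i
    simp [hj]
  simp_rw [h1]
  rw [Finset.sum_comm]
  simp

/-- The setting of sequential gradient descent in terms of the signed data `z i`, the direction `v`
and the limit `b` of the residual. -/
structure StageSetup {E ι : Type*} [NormedAddCommGroup E] [InnerProductSpace ℝ E] {M : ℕ}
    (g : ℝ → ℝ) (β μ U η s : ℝ) (z : ι → E) (v b : E) (S : Finset ι) (α : ι → ℝ)
    (I : Fin M → Finset ι) (K : ℕ) : Prop where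
  rate : ExpTailRate g β μ U
  η_pos : 0 < η
  s_nonneg : 0 ≤ s
  s_lt : s * β < 2
  norm_sum_le : ∀ (J : Finset ι) (c : ι → ℝ),
    η * ‖∑ i ∈ J, c i • z i‖ ^ 2 ≤ s * ∑ i ∈ J, c i ^ 2
  stage_pos : 1 ≤ K
  task_pos : 0 < M
  partition : ∀ i, ∃! j, i ∈ I j
  eq_sum : v = ∑ i ∈ S, α i • z i
  dual_pos : ∀ i ∈ S, 0 < α i
  margin_eq : ∀ i ∈ S, (inner ℝ (z i) v : ℝ) = 1
  margin_gt : ∀ i ∉ S, 1 < (inner ℝ (z i) v : ℝ)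
  target : ∀ i ∈ S, K * (η / M * Real.exp (-inner ℝ (z i) b)) = α i
  coercive : ∃ B, 0 < B ∧ ∀ u ∈ Submodule.span ℝ (z '' S),
    ‖u‖ ^ 2 ≤ B * ∑ i ∈ S, (inner ℝ (z i) u : ℝ) ^ 2
  mem_span : ∀ i, z i ∈ Submodule.span ℝ (z '' S)

namespace StageSetup

variable {E ι : Type*} [NormedAddCommGroup E] [InnerProductSpace ℝ E] {M : ℕ}
  {g : ℝ → ℝ} {β μ U η s : ℝ} {z : ι → E} {v b : E} {S : Finset ι} {α : ι → ℝ}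
  {I : Fin M → Finset ι} {K : ℕ}

lemma one_le_margin (h : StageSetup g β μ U η s z v b S α I K) (i : ι) :
    1 ≤ (inner ℝ (z i) v : ℝ) := by
  by_cases hi : i ∈ S
  · exact (h.margin_eq i hi).ge
  · exact (h.margin_gt i hi).le

/-- A single exponent must serve both the tail error and the finitely many margins above 1. -/
lemma exists_exponent [Finite ι] (h : StageSetup g β μ U η s z v b S α I K) :
    ∃ ε > 0, ε ≤ μ ∧ ∀ i ∉ S, 1 + ε ≤ (inner ℝ (z i) v : ℝ) := by
  have h1 : ∀ i : ι, ∀ᶠ ε in 𝓝[>] (0 : ℝ), i ∉ S → 1 + ε ≤ (inner ℝ (z i) v : ℝ) := fun i => by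
    by_cases hi : i ∈ S
    · simp [hi]
    · have h2 : (0 : ℝ) < inner ℝ (z i) v - 1 := by linarith [h.margin_gt i hi]
      filter_upwards [Ioc_mem_nhdsGT h2] with ε hε _
      linarith [hε.2]
  obtain ⟨ε, h2, h3⟩ := ((eventually_all.2 h1).and (Ioc_mem_nhdsGT h.rate.rate_pos)).exists
  exact ⟨ε, h3.1, h3.2, h2⟩

/-- The average over the tasks of the squared distance to the target after a stage. -/
lemma mean_norm_stage_sq_le [Fintype ι] [DecidableEq ι] (h : StageSetup g β μ U η s z v b S α I K)
    {j : ι → Fin M} (hj : ∀ i l, i ∈ I l ↔ l = j i) (L : ℝ) {lam : ℝ} (hl : 0 ≤ lam) (w : E) :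
    (M : ℝ)⁻¹ * ∑ l, ‖(marginStep g η z (I l))^[K] w - (L + lam) • v - b‖ ^ 2 ≤
      ‖w - L • v - b‖ ^ 2 +
      ((∑ i ∈ S, (η / M * ∑ k ∈ Finset.range K, gain g s 1 (inner ℝ (z i) b) L
          (inner ℝ (z i) ((marginStep g η z (I (j i)))^[k] w)) -
          2 * lam * (α i * (inner ℝ (z i) w - L - inner ℝ (z i) b)))) +
        ∑ i ∈ Sᶜ, η / M * ∑ k ∈ Finset.range K,
          gain g s (inner ℝ (z i) v) (inner ℝ (z i) b) L
          (inner ℝ (z i) ((marginStep g η z (I (j i)))^[k] w))) + lam ^ 2 * ‖v‖ ^ 2 := by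
  have hM : (0 : ℝ) < M := by exact_mod_cast h.task_pos
  have h1 := Finset.sum_le_sum fun l (_ : l ∈ Finset.univ) =>
    norm_stage_sq_le (g := g) (J := I l) (fun u => (h.rate.pos u).le) h.η_pos.le (h.norm_sum_le _)
      (fun i => zero_le_one.trans (h.one_le_margin i)) b L hl w K
  simp only [Finset.sum_add_distrib, Finset.sum_sub_distrib, Finset.sum_const, Finset.card_univ,
    Fintype.card_fin, nsmul_eq_mul, ← Finset.mul_sum] at h1
  have h2 : ∑ l, ∑ k ∈ Finset.range K, ∑ i ∈ I l, gain g s (inner ℝ (z i) v) (inner ℝ (z i) b) L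
        (inner ℝ (z i) ((marginStep g η z (I l))^[k] w)) =
      ∑ i, ∑ k ∈ Finset.range K, gain g s (inner ℝ (z i) v) (inner ℝ (z i) b) L
        (inner ℝ (z i) ((marginStep g η z (I (j i)))^[k] w)) := by
    rw [← sum_sum_partition hj fun l i => ∑ k ∈ Finset.range K, gain g s (inner ℝ (z i) v)
      (inner ℝ (z i) b) L (inner ℝ (z i) ((marginStep g η z (I l))^[k] w))]
    exact Finset.sum_congr rfl fun l _ => Finset.sum_comm
  rw [h2, ← Finset.sum_add_sum_compl S] at h1
  -- The dual representation of `v` splits the effect of the moving target among the support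
  -- vectors, where each share meets the gain of the same point.
  have h3 : (inner ℝ v (w - L • v - b) : ℝ) =
      ∑ i ∈ S, α i * (inner ℝ (z i) w - L - inner ℝ (z i) b) := by
    conv_lhs => rw [h.eq_sum]
    rw [sum_inner]
    refine Finset.sum_congr rfl fun i hi => ?_
    rw [real_inner_smul_left, ← h.eq_sum, inner_sub_right, inner_sub_right, inner_smul_right,
      h.margin_eq i hi, mul_one]
  have h4 : ∑ i ∈ S, ∑ k ∈ Finset.range K,
        gain g s (inner ℝ (z i) v) (inner ℝ (z i) b) L
        (inner ℝ (z i) ((marginStep g η z (I (j i)))^[k] w)) =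
      ∑ i ∈ S, ∑ k ∈ Finset.range K, gain g s 1 (inner ℝ (z i) b) L
        (inner ℝ (z i) ((marginStep g η z (I (j i)))^[k] w)) := by
    refine Finset.sum_congr rfl fun i hi => ?_
    rw [h.margin_eq i hi]
  rw [h4, h3] at h1
  refine (mul_le_mul_of_nonneg_left h1 (inv_pos.2 hM).le).trans (le_of_eq ?_)
  rw [Finset.sum_sub_distrib, ← Finset.mul_sum, ← Finset.mul_sum, ← Finset.mul_sum]
  field_simp
  ring

lemma direction_mem_span (h : StageSetup g β μ U η s z v b S α I K) :
    v ∈ Submodule.span ℝ (z '' S) := by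
  rw [h.eq_sum]
  exact Submodule.sum_mem _ fun i _ => Submodule.smul_mem _ _ (h.mem_span i)

/-- Outside of a large ball the mean squared distance to the target decreases. -/
lemma exists_drift_far [Fintype ι] [DecidableEq ι] (h : StageSetup g β μ U η s z v b S α I K)
    {ε : ℝ} (hε : ∀ i ∉ S, 1 + ε ≤ (inner ℝ (z i) v : ℝ)) (hε1 : ε ≤ 1) :
    ∃ R C, 0 ≤ R ∧ 0 ≤ C ∧ ∀ᶠ L in atTop, ∀ lam, Real.exp (-L) - Real.exp (-L) ^ 2 ≤ lam →
      lam ≤ Real.exp (-L) → ∀ w, (∃ i ∈ S, R < |(inner ℝ (z i) w : ℝ) - L - inner ℝ (z i) b|) →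
      (M : ℝ)⁻¹ * ∑ l, ‖(marginStep g η z (I l))^[K] w - (L + lam) • v - b‖ ^ 2 ≤
        ‖w - L • v - b‖ ^ 2 + C * Real.exp (-((1 + ε) * L)) - Real.exp (-L) := by
  have hM : (0 : ℝ) < M := by exact_mod_cast h.task_pos
  have hκ : 0 < η / M := div_pos h.η_pos hM
  choose j hj hj' using h.partition
  have hjI : ∀ i l, i ∈ I l ↔ l = j i := fun i l => ⟨hj' i l, fun h => h ▸ hj i⟩
  have h1 : ∀ i, ∃ C, i ∈ S → ∀ᶠ L in atTop, ∀ lam, Real.exp (-L) - Real.exp (-L) ^ 2 ≤ lam →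
      lam ≤ Real.exp (-L) → ∀ u : ℕ → ℝ, η / M * ∑ k ∈ Finset.range K,
        gain g s 1 (inner ℝ (z i) b) L (u k) - 2 * lam * (α i * (u 0 - L - inner ℝ (z i) b)) ≤
        (C - α i * |u 0 - L - inner ℝ (z i) b|) * Real.exp (-L) := fun i => by
    by_cases hi : i ∈ S
    · obtain ⟨C, hC⟩ := h.rate.exists_drift_le_sub_abs h.s_nonneg h.s_lt (inner ℝ (z i) b) hκ
        (h.dual_pos i hi) h.stage_pos
      exact ⟨C, fun _ => hC⟩
    · exact ⟨0, fun hi' => absurd hi' hi⟩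
  choose C₁ hC₁ using h1
  have h2 := fun i => h.rate.exists_drift_le h.s_nonneg h.s_lt (h.one_le_margin i)
    (inner ℝ (z i) b) hκ K
  choose C₂ hC₂0 hC₂ using h2
  have hT : 0 ≤ ∑ i ∈ S, |C₁ i| + 1 := by positivity
  -- A single deviation beyond this radius contributes at least `∑ |C₁ i| + 1`, so the support
  -- vectors together contribute at most `-exp (-L)`.
  refine ⟨∑ i ∈ S, (∑ i ∈ S, |C₁ i| + 1) / α i, ∑ i ∈ Sᶜ, C₂ i + ‖v‖ ^ 2,
    Finset.sum_nonneg fun i hi => div_nonneg hT (h.dual_pos i hi).le,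
    add_nonneg (Finset.sum_nonneg fun i _ => hC₂0 i) (sq_nonneg _), ?_⟩
  have h3 : ∀ᶠ L in atTop, ∀ i, i ∈ S → _ := eventually_all.2 fun i => by
    by_cases hi : i ∈ S
    · filter_upwards [hC₁ i hi] with L hL _ using hL
    · exact Eventually.of_forall fun _ hi' => absurd hi' hi
  filter_upwards [h3, eventually_all.2 hC₂, eventually_ge_atTop 0] with L hL1 hL2 hL0 lam hl1 hl2 w
  rintro ⟨i₀, hi₀, hR⟩
  set e := Real.exp (-L) with he
  set q := Real.exp (-((1 + ε) * L)) with hq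
  have he0 : 0 < e := Real.exp_pos _
  have he1 : e ≤ 1 := Real.exp_le_one_iff.2 (by linarith)
  have heq : e ^ 2 ≤ q := by
    rw [he, hq, ← Real.exp_nat_mul]
    exact Real.exp_le_exp.2 (by push_cast; nlinarith)
  have hl0 : 0 ≤ lam := by nlinarith
  refine (h.mean_norm_stage_sq_le hjI L hl0 w).trans ?_
  have h4 := Finset.sum_le_sum fun i (hi : i ∈ S) => hL1 i hi lam hl1 hl2
    fun k => inner ℝ (z i) ((marginStep g η z (I (j i)))^[k] w)
  simp only [Function.iterate_zero, id_eq] at h4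
  have h5 := Finset.sum_le_sum fun i (hi : i ∈ Sᶜ) => (hL2 i
    fun k => inner ℝ (z i) ((marginStep g η z (I (j i)))^[k] w)).trans
    (mul_le_mul_of_nonneg_left (Real.exp_le_exp.2 (neg_le_neg (mul_le_mul_of_nonneg_right
      (hε i (Finset.mem_compl.1 hi)) hL0))) (hC₂0 i))
  rw [← Finset.sum_mul] at h4 h5
  have h6 : ∑ i ∈ S, (C₁ i - α i * |(inner ℝ (z i) w : ℝ) - L - inner ℝ (z i) b|) ≤ -1 := by
    rw [Finset.sum_sub_distrib]
    have h7 : ∑ i ∈ S, C₁ i ≤ ∑ i ∈ S, |C₁ i| := Finset.sum_le_sum fun i _ => le_abs_self _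
    have h8 := Finset.single_le_sum (f := fun i => α i * |(inner ℝ (z i) w : ℝ) - L -
      inner ℝ (z i) b|) (fun i hi => mul_nonneg (h.dual_pos i hi).le (abs_nonneg _)) hi₀
    have h9 := Finset.single_le_sum (f := fun i => (∑ i ∈ S, |C₁ i| + 1) / α i)
      (fun i hi => div_nonneg hT (h.dual_pos i hi).le) hi₀
    have h10 := (div_le_iff₀ (h.dual_pos i₀ hi₀)).1 (h9.trans hR.le)
    linarith
  have h11 : lam ^ 2 * ‖v‖ ^ 2 ≤ ‖v‖ ^ 2 * q := by
    rw [mul_comm]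
    gcongr
    exact (pow_le_pow_left₀ hl0 hl2 2).trans heq
  have h12 := mul_le_mul_of_nonneg_right h6 he0.le
  linarith

/-- In a ball the mean squared distance to the target decreases proportionally. -/
lemma exists_drift_near [Fintype ι] [DecidableEq ι] (h : StageSetup g β μ U η s z v b S α I K)
    {ε : ℝ} (hε : ∀ i ∉ S, 1 + ε ≤ (inner ℝ (z i) v : ℝ)) (hεμ : ε ≤ μ) {R : ℝ} (hR : 0 ≤ R) :
    ∃ C c, 0 ≤ C ∧ 0 < c ∧ ∀ᶠ L in atTop, ∀ lam, Real.exp (-L) - Real.exp (-L) ^ 2 ≤ lam →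
      lam ≤ Real.exp (-L) → ∀ w, w - b ∈ Submodule.span ℝ (z '' S) →
      (∀ i ∈ S, |(inner ℝ (z i) w : ℝ) - L - inner ℝ (z i) b| ≤ R) →
      (M : ℝ)⁻¹ * ∑ l, ‖(marginStep g η z (I l))^[K] w - (L + lam) • v - b‖ ^ 2 ≤
        ‖w - L • v - b‖ ^ 2 + C * Real.exp (-((1 + ε) * L)) -
          c * ‖w - L • v - b‖ ^ 2 * Real.exp (-L) := by
  have hM : (0 : ℝ) < M := by exact_mod_cast h.task_pos
  have hκ : 0 < η / M := div_pos h.η_pos hM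
  choose j hj hj' using h.partition
  have hjI : ∀ i l, i ∈ I l ↔ l = j i := fun i l => ⟨hj' i l, fun h => h ▸ hj i⟩
  obtain ⟨B, hB0, hB⟩ := h.coercive
  -- By coercivity, deviations at most `R` on `S` put `w` within `R₂` of the target. All margins,
  -- also those off `S`, are then at least `L - c₀`, so the iterates barely move within the stage.
  set R₂ := Real.sqrt (B * (S.card * R ^ 2)) with hR₂
  set c₀ := ∑ i, (|(inner ℝ (z i) b : ℝ)| + ‖z i‖ * R₂) with hc₀
  obtain ⟨D, L₀, hD0, hD⟩ := exists_norm_iterate_marginStep_sub_le h.rate h.η_pos.le z c₀ K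
  have h1 : ∀ i, ∃ C, i ∈ S → ∀ᶠ L in atTop, ∀ lam, Real.exp (-L) - Real.exp (-L) ^ 2 ≤ lam →
      lam ≤ Real.exp (-L) → ∀ u : ℕ → ℝ, |u 0 - L - inner ℝ (z i) b| ≤ R →
      (∀ k < K, |u k - u 0| ≤ ‖z i‖ * D * Real.exp (-L)) → η / M * ∑ k ∈ Finset.range K,
        gain g s 1 (inner ℝ (z i) b) L (u k) - 2 * lam * (α i * (u 0 - L - inner ℝ (z i) b)) ≤
        -(2 * α i / (1 + R) * (u 0 - L - inner ℝ (z i) b) ^ 2) * Real.exp (-L) +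
          C * Real.exp (-((1 + μ) * L)) := fun i => by
    by_cases hi : i ∈ S
    · obtain ⟨C, hC⟩ := h.rate.exists_drift_le_sub_sq h.s_nonneg (inner ℝ (z i) b) hκ
        (h.dual_pos i hi) (h.target i hi) hR (D := ‖z i‖ * D) (by positivity)
      exact ⟨C, fun _ => hC⟩
    · exact ⟨0, fun hi' => absurd hi' hi⟩
  choose C₁ hC₁ using h1
  have h2 := fun i => h.rate.exists_drift_le h.s_nonneg h.s_lt (h.one_le_margin i)
    (inner ℝ (z i) b) hκ K
  choose C₂ hC₂0 hC₂ using h2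
  obtain ⟨a, ha0, ha⟩ : ∃ a > 0, ∀ i ∈ S, a ≤ α i := by
    have h3 : ∀ i : ι, ∀ᶠ a in 𝓝[>] (0 : ℝ), i ∈ S → a ≤ α i := fun i => by
      by_cases hi : i ∈ S
      · filter_upwards [Ioc_mem_nhdsGT (h.dual_pos i hi)] with a ha _ using ha.2
      · simp [hi]
    obtain ⟨a, h4, h5⟩ := ((eventually_all.2 h3).and self_mem_nhdsWithin).exists
    exact ⟨a, h5, h4⟩
  refine ⟨∑ i ∈ S, |C₁ i| + ∑ i ∈ Sᶜ, C₂ i + ‖v‖ ^ 2, 2 * a / (1 + R) / B, ?_, by positivity, ?_⟩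
  · have := Finset.sum_nonneg fun i (_ : i ∈ Sᶜ) => hC₂0 i
    positivity
  have h3 : ∀ᶠ L in atTop, ∀ i, i ∈ S → _ := eventually_all.2 fun i => by
    by_cases hi : i ∈ S
    · filter_upwards [hC₁ i hi] with L hL _ using hL
    · exact Eventually.of_forall fun _ hi' => absurd hi' hi
  filter_upwards [h3, eventually_all.2 hC₂, eventually_ge_atTop 0, eventually_ge_atTop L₀]
    with L hL1 hL2 hL0 hLL lam hl1 hl2 w hw hwR
  set e := Real.exp (-L) with he
  set q := Real.exp (-((1 + ε) * L)) with hq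
  have he0 : 0 < e := Real.exp_pos _
  have he1 : e ≤ 1 := Real.exp_le_one_iff.2 (by linarith)
  have hμ1 := h.rate.rate_le
  have heq : e ^ 2 ≤ q := by
    rw [he, hq, ← Real.exp_nat_mul]
    exact Real.exp_le_exp.2 (by push_cast; nlinarith)
  have hl0 : 0 ≤ lam := by nlinarith
  have hu : w - L • v - b ∈ Submodule.span ℝ (z '' S) := by
    have := Submodule.sub_mem _ hw (Submodule.smul_mem _ L h.direction_mem_span)
    rwa [sub_right_comm] at this
  have hin : ∀ i ∈ S, (inner ℝ (z i) (w - L • v - b) : ℝ) =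
      inner ℝ (z i) w - L - inner ℝ (z i) b := fun i hi => by
    rw [inner_sub_right, inner_sub_right, inner_smul_right, h.margin_eq i hi, mul_one]
  have hBu := hB _ hu
  rw [Finset.sum_congr rfl fun i hi => by rw [hin i hi]] at hBu
  have hnorm : ‖w - L • v - b‖ ≤ R₂ := by
    refine Real.le_sqrt_of_sq_le (hBu.trans (mul_le_mul_of_nonneg_left ?_ hB0.le))
    rw [← nsmul_eq_mul]
    exact Finset.sum_le_card_nsmul _ _ _ fun i hi => sq_le_sq' (by linarith [(abs_le.1 (hwR i hi)).1])
      (abs_le.1 (hwR i hi)).2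
  have hlow : ∀ i, L - c₀ ≤ inner ℝ (z i) w := fun i => by
    have h4 : (inner ℝ (z i) w : ℝ) = inner ℝ (z i) (w - L • v - b) + L * inner ℝ (z i) v +
        inner ℝ (z i) b := by
      rw [inner_sub_right, inner_sub_right, inner_smul_right]; ring
    have h5 := (abs_le.1 (abs_real_inner_le_norm (z i) (w - L • v - b))).1
    have h6 := mul_le_mul_of_nonneg_left hnorm (norm_nonneg (z i))
    have h7 := neg_abs_le (inner ℝ (z i) b : ℝ)
    have h8 := Finset.single_le_sum (f := fun i => |(inner ℝ (z i) b : ℝ)| + ‖z i‖ * R₂)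
      (fun i _ => by positivity) (Finset.mem_univ i)
    have h9 := mul_le_mul_of_nonneg_left (h.one_le_margin i) hL0
    linarith
  refine (h.mean_norm_stage_sq_le hjI L hl0 w).trans ?_
  have h4 := Finset.sum_le_sum fun i (hi : i ∈ S) => hL1 i hi lam hl1 hl2
    (fun k => inner ℝ (z i) ((marginStep g η z (I (j i)))^[k] w)) (hwR i hi) fun k hk => by
      simp only [Function.iterate_zero, id_eq]
      rw [← inner_sub_right, mul_assoc]
      exact (abs_real_inner_le_norm _ _).trans
        (mul_le_mul_of_nonneg_left (hD L hLL w hlow _ k hk.le) (norm_nonneg _))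
  simp only [Function.iterate_zero, id_eq] at h4
  have h5 := Finset.sum_le_sum fun i (hi : i ∈ Sᶜ) => (hL2 i
    fun k => inner ℝ (z i) ((marginStep g η z (I (j i)))^[k] w)).trans
    (mul_le_mul_of_nonneg_left (Real.exp_le_exp.2 (neg_le_neg (mul_le_mul_of_nonneg_right
      (hε i (Finset.mem_compl.1 hi)) hL0))) (hC₂0 i))
  rw [← Finset.sum_mul] at h5
  rw [Finset.sum_add_distrib, ← Finset.sum_mul, ← Finset.sum_mul, Finset.sum_neg_distrib] at h4
  have h6 : (∑ i ∈ S, C₁ i) * Real.exp (-((1 + μ) * L)) ≤ (∑ i ∈ S, |C₁ i|) * q := by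
    have h7 : ∑ i ∈ S, C₁ i ≤ ∑ i ∈ S, |C₁ i| := Finset.sum_le_sum fun i _ => le_abs_self _
    have h8 : Real.exp (-((1 + μ) * L)) ≤ q := Real.exp_le_exp.2 (by nlinarith)
    refine (mul_le_mul_of_nonneg_right h7 (Real.exp_pos _).le).trans ?_
    gcongr
  have h9 : 2 * a / (1 + R) / B * ‖w - L • v - b‖ ^ 2 ≤ ∑ i ∈ S, 2 * α i / (1 + R) *
      ((inner ℝ (z i) w : ℝ) - L - inner ℝ (z i) b) ^ 2 := by
    calc 2 * a / (1 + R) / B * ‖w - L • v - b‖ ^ 2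
        ≤ 2 * a / (1 + R) / B * (B * ∑ i ∈ S, ((inner ℝ (z i) w : ℝ) - L - inner ℝ (z i) b) ^ 2) :=
          mul_le_mul_of_nonneg_left hBu (by positivity)
      _ = ∑ i ∈ S, 2 * a / (1 + R) * ((inner ℝ (z i) w : ℝ) - L - inner ℝ (z i) b) ^ 2 := by
          rw [← Finset.mul_sum]; field_simp
      _ ≤ _ := Finset.sum_le_sum fun i hi => by
          have := ha i hi
          gcongr
  have h11 : lam ^ 2 * ‖v‖ ^ 2 ≤ ‖v‖ ^ 2 * q := by
    rw [mul_comm]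
    gcongr
    exact (pow_le_pow_left₀ hl0 hl2 2).trans heq
  have h12 := mul_le_mul_of_nonneg_right h9 he0.le
  linarith

/-- The drift inequality for the squared distance to the moving target. -/
theorem exists_drift [Fintype ι] (h : StageSetup g β μ U η s z v b S α I K) :
    ∃ ε C c, 0 < ε ∧ 0 ≤ C ∧ 0 < c ∧ ∀ᶠ L in atTop, ∀ lam,
      Real.exp (-L) - Real.exp (-L) ^ 2 ≤ lam → lam ≤ Real.exp (-L) →
      ∀ w, w - b ∈ Submodule.span ℝ (z '' S) →
      (M : ℝ)⁻¹ * ∑ l, ‖(marginStep g η z (I l))^[K] w - (L + lam) • v - b‖ ^ 2 ≤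
        ‖w - L • v - b‖ ^ 2 + C * Real.exp (-((1 + ε) * L)) -
          min 1 (c * ‖w - L • v - b‖ ^ 2) * Real.exp (-L) := by
  classical
  obtain ⟨ε, hε0, hεμ, hε⟩ := h.exists_exponent
  obtain ⟨R, C₁, hR, hC₁, h1⟩ := h.exists_drift_far hε (hεμ.trans h.rate.rate_le)
  obtain ⟨C₂, c, hC₂, hc, h2⟩ := h.exists_drift_near hε hεμ hR
  refine ⟨ε, C₁ + C₂, c, hε0, by positivity, hc, ?_⟩
  filter_upwards [h1, h2] with L h1 h2 lam hl1 hl2 w hw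
  have he := Real.exp_pos (-L)
  have hq := Real.exp_pos (-((1 + ε) * L))
  have hq1 := mul_nonneg hC₁ hq.le
  have hq2 := mul_nonneg hC₂ hq.le
  by_cases hR' : ∃ i ∈ S, R < |(inner ℝ (z i) w : ℝ) - L - inner ℝ (z i) b|
  · have h3 := h1 lam hl1 hl2 w hR'
    have h4 := mul_le_mul_of_nonneg_right (min_le_left 1 (c * ‖w - L • v - b‖ ^ 2)) he.le
    linarith
  · push Not at hR'
    have h3 := h2 lam hl1 hl2 w hw hR'
    have h4 := mul_le_mul_of_nonneg_right (min_le_right 1 (c * ‖w - L • v - b‖ ^ 2)) he.le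
    linarith

end StageSetup

/-! ### Almost supermartingales driven by independent uniform tasks. -/

section Probability

variable {Ω : Type*} {m0 : MeasurableSpace Ω} {P : Measure Ω} [IsProbabilityMeasure P]

/-- An almost supermartingale in the sense of Robbins and Siegmund whose decrease at time `n` is at
least `a n * min 1 (c * V n)` with `∑ a n = ∞` converges to zero. -/
theorem ae_tendsto_zero_of_setIntegral_drift {𝒢 : Filtration ℕ m0} {V : ℕ → Ω → ℝ}
    (hadp : StronglyAdapted 𝒢 V) (hint : ∀ n, Integrable (V n) P) (hV : ∀ n ω, 0 ≤ V n ω)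
    {e a : ℕ → ℝ} (he0 : ∀ n, 0 ≤ e n) (he : Summable e) (ha0 : ∀ n, 0 ≤ a n) (ha : ¬ Summable a)
    {c : ℝ} (hc : 0 < c)
    (hdrift : ∀ n (A : Set Ω), MeasurableSet[𝒢 n] A →
      ∫ ω in A, V (n + 1) ω ∂P ≤ ∫ ω in A, (V n ω + e n - a n * min 1 (c * V n ω)) ∂P) :
    ∀ᵐ ω ∂P, Tendsto (fun n => V n ω) atTop (𝓝 0) := by
  set u : ℕ → Ω → ℝ := fun n ω => min 1 (c * V n ω) with hu
  have hu0 : ∀ n ω, 0 ≤ u n ω := fun n ω => le_min zero_le_one (mul_nonneg hc.le (hV n ω))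
  have hu1 : ∀ n ω, u n ω ≤ 1 := fun n ω => min_le_left _ _
  have hum : ∀ n, AEStronglyMeasurable (u n) P := fun n =>
    aestronglyMeasurable_const.inf ((hint n).aestronglyMeasurable.const_mul c)
  have hui : ∀ n, Integrable (u n) P := fun n =>
    Integrable.of_bound (hum n) 1 (Eventually.of_forall fun ω => by
      rw [Real.norm_of_nonneg (hu0 n ω)]; exact hu1 n ω)
  set r : ℕ → ℝ := fun n => ∑' k, e (k + n) with hr
  have hr0 : ∀ n, 0 ≤ r n := fun n => tsum_nonneg fun k => he0 _
  have hrs : ∀ n, r n = e n + r (n + 1) := fun n => by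
    rw [hr]
    simp only
    rw [((summable_nat_add_iff n).2 he).tsum_eq_zero_add]
    simp only [zero_add, add_right_comm, add_assoc]
  have hrt : Tendsto r atTop (𝓝 0) := tendsto_sum_nat_add e
  -- Adding the tail sums of the errors turns `V` into a nonnegative supermartingale, to which the
  -- convergence theorem applies.
  set Y : ℕ → Ω → ℝ := fun n ω => V n ω + r n with hY
  have hYi : ∀ n, Integrable (Y n) P := fun n => (hint n).add (integrable_const _)
  have hYstep : ∀ n (A : Set Ω), MeasurableSet[𝒢 n] A →
      ∫ ω in A, Y (n + 1) ω ∂P ≤ ∫ ω in A, Y n ω ∂P := fun n A hA => by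
    have h1 := hdrift n A hA
    have h2 : ∫ ω in A, (V n ω + e n - a n * u n ω) ∂P ≤ ∫ ω in A, (V n ω + e n) ∂P := by
      refine integral_mono (((hint n).add (integrable_const _)).sub ((hui n).const_mul _)).restrict
        ((hint n).add (integrable_const _)).restrict fun ω => ?_
      have := mul_nonneg (ha0 n) (hu0 n ω)
      simp only
      linarith
    have h3 : ∀ (f : Ω → ℝ) (x : ℝ), Integrable f P →
        ∫ ω in A, (f ω + x) ∂P = ∫ ω in A, f ω ∂P + ∫ _ in A, x ∂P := fun f x hf =>
      integral_add hf.restrict (integrable_const _)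
    have h4 : ∫ _ in A, r n ∂P = ∫ _ in A, e n ∂P + ∫ _ in A, r (n + 1) ∂P := by
      rw [← integral_add (integrable_const _) (integrable_const _), ← hrs]
    rw [h3 _ _ (hint n)] at h2
    rw [hY]
    simp only
    rw [h3 _ _ (hint n), h3 _ _ (hint (n + 1)), h4]
    linarith
  have hsup : Supermartingale Y 𝒢 P :=
    supermartingale_of_setIntegral_succ_le (fun n => (hadp n).add stronglyMeasurable_const)
      hYi hYstep
  have hbdd : ∀ n, eLpNorm ((-Y) n) 1 P ≤ (Real.toNNReal (∫ ω, Y 0 ω ∂P) : ENNReal) := fun n => by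
    rw [Pi.neg_apply, eLpNorm_neg, eLpNorm_one_eq_lintegral_enorm,
      ← ofReal_integral_norm_eq_lintegral_enorm (hYi n)]
    refine ENNReal.ofReal_le_ofReal ?_
    have h1 : ∀ ω, ‖Y n ω‖ = Y n ω := fun ω => Real.norm_of_nonneg (add_nonneg (hV n ω) (hr0 n))
    simp only [h1]
    have := hsup.setIntegral_le (Nat.zero_le n) MeasurableSet.univ
    simpa using this
  obtain ⟨Z, hlim⟩ : ∃ Z : Ω → ℝ, ∀ᵐ ω ∂P, Tendsto (fun n => (-Y) n ω) atTop (𝓝 (Z ω)) := by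
    refine ⟨fun ω => limUnder atTop fun n => (-Y) n ω, ?_⟩
    filter_upwards [hsup.neg.exists_ae_tendsto_of_bdd hbdd] with ω hω using
      tendsto_nhds_limUnder hω
  have hVlim : ∀ᵐ ω ∂P, Tendsto (fun n => V n ω) atTop (𝓝 (-Z ω)) := by
    filter_upwards [hlim] with ω hω
    have := hω.neg.sub hrt
    simpa [hY] using this
  have hulim : ∀ᵐ ω ∂P, Tendsto (fun n => u n ω) atTop (𝓝 (min 1 (c * -Z ω))) := by
    filter_upwards [hVlim] with ω hω
    exact tendsto_const_nhds.min (hω.const_mul c)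
  have hplim := tendsto_integral_of_dominated_convergence (fun _ => (1 : ℝ)) hum
    (integrable_const _) (fun n => Eventually.of_forall fun ω => by
      rw [Real.norm_of_nonneg (hu0 n ω)]; exact hu1 n ω) hulim
  have hp0 : ∀ n, 0 ≤ ∫ ω, u n ω ∂P := fun n => integral_nonneg (hu0 n)
  -- Telescoping the drift over the whole space bounds the total expected decrease.
  have hsum : Summable fun n => a n * ∫ ω, u n ω ∂P := by
    refine summable_of_sum_range_le (c := ∫ ω, V 0 ω ∂P + ∑' n, e n)
      (fun n => mul_nonneg (ha0 n) (hp0 n)) fun n => ?_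
    have h1 : ∀ n, ∑ k ∈ Finset.range n, a k * ∫ ω, u k ω ∂P + ∫ ω, V n ω ∂P ≤
        ∫ ω, V 0 ω ∂P + ∑ k ∈ Finset.range n, e k := fun n => by
      induction n with
      | zero => simp
      | succ n ih =>
        have h2 := hdrift n Set.univ MeasurableSet.univ
        simp only [Measure.restrict_univ] at h2
        have h6 : ∫ ω, (V n ω + e n - a n * u n ω) ∂P =
            ∫ ω, V n ω ∂P + e n - a n * ∫ ω, u n ω ∂P := by
          rw [integral_sub (f := fun ω => V n ω + e n) ((hint n).add (integrable_const _))
            ((hui n).const_mul _), integral_add (hint n) (integrable_const _), integral_const_mul]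
          simp
        rw [h6] at h2
        rw [Finset.sum_range_succ, Finset.sum_range_succ]
        linarith
    have h3 := h1 n
    have h4 := he.sum_le_tsum (Finset.range n) fun k _ => he0 k
    have h5 : 0 ≤ ∫ ω, V n ω ∂P := integral_nonneg (hV n)
    linarith
  -- The means of `u n` converge; a positive limit would make `a` summable by comparison.
  have hzero : ∫ ω, min 1 (c * -Z ω) ∂P = 0 := by
    by_contra hne
    have hpos : 0 < ∫ ω, min 1 (c * -Z ω) ∂P :=
      lt_of_le_of_ne (ge_of_tendsto' hplim hp0) (Ne.symm hne)
    set p := ∫ ω, min 1 (c * -Z ω) ∂P with hp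
    obtain ⟨n₀, hn₀⟩ := eventually_atTop.1 (hplim.eventually_const_le (half_lt_self hpos))
    refine ha ((summable_nat_add_iff n₀).1 (Summable.of_nonneg_of_le (fun n => ha0 _) (fun n => ?_)
      (((summable_nat_add_iff n₀).2 hsum).mul_left (p / 2)⁻¹)))
    have h1 := hn₀ (n + n₀) (by omega)
    have h2 := mul_le_mul_of_nonneg_left h1 (ha0 (n + n₀))
    rw [← div_eq_inv_mul, le_div_iff₀ (half_pos hpos)]
    exact h2
  have hnn : ∀ᵐ ω ∂P, 0 ≤ min 1 (c * -Z ω) := by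
    filter_upwards [hulim] with ω hω
    exact ge_of_tendsto' hω fun n => hu0 n ω
  have hmi : Integrable (fun ω => min 1 (c * -Z ω)) P := by
    refine Integrable.of_bound (aestronglyMeasurable_of_tendsto_ae _ hum hulim) 1 ?_
    filter_upwards [hnn] with ω hω
    rw [Real.norm_of_nonneg hω]
    exact min_le_left _ _
  have hae := (integral_eq_zero_iff_of_nonneg_ae hnn hmi).1 hzero
  filter_upwards [hVlim, hae] with ω h1 h2
  have h3 : c * -Z ω = 0 := by
    rcases min_choice 1 (c * -Z ω) with h4 | h4
    · rw [Pi.zero_apply, h4] at h2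
      exact absurd h2 one_ne_zero
    · rw [Pi.zero_apply, h4] at h2
      exact h2
  rw [(mul_eq_zero.1 h3).resolve_left hc.ne'] at h1
  exact h1

/-- Averaging over an independent uniform task. -/
lemma integral_indepFun_uniform {X : Type*} [Finite X] [MeasurableSpace X]
    [DiscreteMeasurableSpace X] {M : ℕ} {p : Ω → X} {q : Ω → Fin M} (hp : Measurable p)
    (hq : Measurable q) (hpq : IndepFun p q P) (hu : ∀ j, P (q ⁻¹' {j}) = (M : ENNReal)⁻¹)
    (Q : X → Fin M → ℝ) :
    ∫ ω, Q (p ω) (q ω) ∂P = ∫ ω, (M : ℝ)⁻¹ * ∑ j, Q (p ω) j ∂P := by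
  classical
  have hint : ∀ f : X → ℝ, Integrable (fun ω => f (p ω)) P := fun f =>
    (Integrable.of_finite (μ := P.map p)).comp_measurable (g := f) hp
  have h1 : ∀ ω, Q (p ω) (q ω) = ∑ j, Q (p ω) j * (if q ω = j then 1 else 0) := fun ω => by simp
  have h2 : ∀ j, ∫ ω, Q (p ω) j * (if q ω = j then (1 : ℝ) else 0) ∂P =
      (∫ ω, Q (p ω) j ∂P) * (M : ℝ)⁻¹ := fun j => by
    rw [hpq.integral_fun_comp_mul_comp (f := fun x => Q x j)
      (g := fun i => if i = j then (1 : ℝ) else 0) hp.aemeasurable hq.aemeasurable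
      (measurable_of_finite _).aestronglyMeasurable (measurable_of_finite _).aestronglyMeasurable]
    congr 1
    have h3 : (fun ω => if q ω = j then (1 : ℝ) else 0) = (q ⁻¹' {j}).indicator 1 := by
      ext ω; simp [Set.indicator_apply]
    rw [h3, integral_indicator_one (hq (measurableSet_singleton j)), measureReal_def, hu]
    simp
  simp_rw [h1]
  rw [integral_finsetSum]
  · simp_rw [h2]
    rw [integral_const_mul, integral_finsetSum _ fun j _ => hint fun x => Q x j, ← Finset.sum_mul,
      mul_comm]
  · intro j _
    have h4 : Integrable (fun ω => if q ω = j then (1 : ℝ) else 0) P :=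
      (Integrable.of_finite (μ := P.map q)).comp_measurable
        (g := fun i => if i = j then (1 : ℝ) else 0) hq
    exact (hint fun x => Q x j).mul_bdd (c := 1) h4.aestronglyMeasurable
      (Eventually.of_forall fun ω => by split_ifs <;> simp)

/-- A process driven by independent uniform tasks, along which a nonnegative function has
a Robbins-Siegmund drift. -/
theorem ae_tendsto_zero_of_mean_drift {M : ℕ} {m : ℕ → Ω → Fin M}
    (hm_meas : ∀ t, Measurable (m t)) (hm_indep : iIndepFun m P)
    (hm_unif : ∀ t (j : Fin M), P (m t ⁻¹' {j}) = (M : ENNReal)⁻¹)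
    {X : Type*} {F : Fin M → X → X} {w : ℕ → Ω → X} {w₀ : X} (hw0 : ∀ ω, w 0 ω = w₀)
    (hw : ∀ t ω, w (t + 1) ω = F (m t ω) (w t ω)) {φ : ℕ → X → ℝ} (hφ : ∀ t x, 0 ≤ φ t x)
    {p : X → Prop} (hp0 : p w₀) (hpF : ∀ j x, p x → p (F j x))
    {e a : ℕ → ℝ} (he0 : ∀ n, 0 ≤ e n) (he : Summable e) (ha0 : ∀ n, 0 ≤ a n) (ha : ¬ Summable a)
    {c : ℝ} (hc : 0 < c)
    (hdrift : ∀ᶠ t in atTop, ∀ x, p x → (M : ℝ)⁻¹ * ∑ j, φ (t + 1) (F j x) ≤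
      φ t x + e t - a t * min 1 (c * φ t x)) :
    ∀ᵐ ω ∂P, Tendsto (fun t => φ t (w t ω)) atTop (𝓝 0) := by
  obtain ⟨T, hT⟩ := eventually_atTop.1 hdrift
  -- The past is a tuple in a finite type and `w t` is a function of it. Measurability and
  -- integrability are therefore automatic, without a measurable structure on `X`.
  set π : (t : ℕ) → Ω → (Finset.range t → Fin M) := fun t ω i => m i ω with hπ
  have hπm : ∀ t, Measurable (π t) := fun t => measurable_pi_lambda _ fun i => hm_meas i
  have hh : ∀ t, ∃ h : (Finset.range t → Fin M) → X, ∀ ω, w t ω = h (π t ω) := fun t => by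
    induction t with
    | zero => exact ⟨fun _ => w₀, hw0⟩
    | succ t ih =>
      obtain ⟨h, hh⟩ := ih
      refine ⟨fun f => F (f ⟨t, Finset.self_mem_range_succ t⟩)
        (h fun i => f ⟨i, Finset.range_subset_range.2 t.le_succ i.2⟩), fun ω => ?_⟩
      rw [hw, hh]
  choose h hh using hh
  have hpw : ∀ t ω, p (w t ω) := fun t ω => by
    induction t with
    | zero => rw [hw0]; exact hp0
    | succ t ih => rw [hw]; exact hpF _ _ ih
  -- Time is shifted by `T` because the drift inequality holds only from `T` on.
  let 𝒢 : Filtration ℕ m0 :=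
    { seq := fun n => MeasurableSpace.comap (π (n + T)) inferInstance
      mono' := fun n k hnk => by
        have h1 : π (n + T) = (fun f (i : Finset.range (n + T)) =>
            f ⟨i, Finset.range_subset_range.2 (Nat.add_le_add_right hnk T) i.2⟩) ∘ π (k + T) := rfl
        simp only
        rw [h1, ← MeasurableSpace.comap_comp]
        exact MeasurableSpace.comap_mono (measurable_of_finite _).comap_le
      le' := fun n => (hπm _).comap_le }
  have hint : ∀ t (f : (Finset.range t → Fin M) → ℝ), Integrable (fun ω => f (π t ω)) P :=
    fun t f => (Integrable.of_finite (μ := P.map (π t))).comp_measurable (g := f) (hπm t)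
  suffices hs : ∀ᵐ ω ∂P, Tendsto (fun n => φ (n + T) (w (n + T) ω)) atTop (𝓝 0) by
    filter_upwards [hs] with ω hω
    exact (tendsto_add_atTop_iff_nat T).1 hω
  refine ae_tendsto_zero_of_setIntegral_drift (𝒢 := 𝒢) (fun n => ?_) (fun n => ?_)
    (fun n ω => hφ _ _) (fun n => he0 (n + T)) ((summable_nat_add_iff T).2 he)
    (fun n => ha0 (n + T)) (fun hs => ha ((summable_nat_add_iff T).1 hs)) hc ?_
  · simp_rw [hh]
    have h1 : Measurable[𝒢 n] (π (n + T)) := comap_measurable _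
    exact ((measurable_of_finite fun x => φ (n + T) (h (n + T) x)).comp h1).stronglyMeasurable
  · simp_rw [hh]
    exact hint _ fun x => φ (n + T) (h (n + T) x)
  · intro n A hA
    classical
    have hTn : T ≤ n + T := Nat.le_add_left T n
    change MeasurableSet[MeasurableSpace.comap (π (n + T)) inferInstance] A at hA
    rw [add_right_comm n 1 T]
    generalize n + T = t at hA hTn ⊢
    obtain ⟨B, hB, rfl⟩ := hA
    have hBm : MeasurableSet (π t ⁻¹' B) := hπm t hB
    have hind : IndepFun (π t) (m t) P := by
      have h1 := hm_indep.indepFun_finset (Finset.range t) {t} (by simp) hm_meas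
      exact h1.comp (φ := id) (ψ := fun f : ({t} : Finset ℕ) → Fin M =>
        f ⟨t, Finset.mem_singleton_self t⟩) measurable_id (measurable_pi_apply _)
    rw [← integral_indicator hBm, ← integral_indicator hBm]
    have h1 : (π t ⁻¹' B).indicator (fun ω => φ (t + 1) (w (t + 1) ω)) =
        fun ω => (fun x j => if x ∈ B then φ (t + 1) (F j (h t x)) else 0) (π t ω) (m t ω) := by
      ext ω
      rw [Set.indicator_apply]
      simp only [Set.mem_preimage, hw, ← hh]
    rw [h1, integral_indepFun_uniform (hπm t) (hm_meas t) hind (hm_unif t)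
      fun x j => if x ∈ B then φ (t + 1) (F j (h t x)) else 0]
    refine integral_mono (hint t fun x => (M : ℝ)⁻¹ * ∑ j, if x ∈ B then
      φ (t + 1) (F j (h t x)) else 0) ?_ fun ω => ?_
    · refine Integrable.indicator ?_ hBm
      simp_rw [hh]
      exact hint t fun x => φ t (h t x) + e t - a t * min 1 (c * φ t (h t x))
    · simp only [Set.indicator_apply, Set.mem_preimage]
      split_ifs with h2
      · simp only [← hh]
        exact hT t hTn _ (hpw t ω)
      · simp

end Probability

/-! ### From the loss to its negative derivative. -/

section Loss

variable {ℓ : ℝ → ℝ} {β : ℝ}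

lemma LossShape.continuous_deriv (h : LossShape ℓ β) : Continuous (deriv ℓ) := by
  have h1 : LipschitzWith (Real.toNNReal β) (deriv ℓ) := LipschitzWith.of_dist_le_mul fun u v => by
    rw [Real.dist_eq, Real.dist_eq]
    exact (h.smooth u v).trans
      (mul_le_mul_of_nonneg_right (Real.le_coe_toNNReal β) (abs_nonneg _))
  exact h1.continuous

/-- Near $-\infty$ the bound comes from the limsup, on the remaining compact interval from
continuity and negativity of the derivative. -/
lemma LossShape.exists_le_neg_deriv (h : LossShape ℓ β) (B : ℝ) :
    ∃ κ > 0, ∀ u ≤ B, κ ≤ -deriv ℓ u := by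
  obtain ⟨q, hq1, hq2⟩ := EReal.lt_iff_exists_real_btwn.1 h.limsup_neg
  obtain ⟨A, hA⟩ := eventually_atBot.1 (eventually_lt_of_limsup_lt hq1)
  obtain ⟨u₀, -, hu₀⟩ := (isCompact_Icc (a := min A B) (b := B)).exists_isMaxOn
    (Set.nonempty_Icc.2 (min_le_right A B)) h.continuous_deriv.continuousOn
  have hq : q < 0 := by exact_mod_cast hq2
  refine ⟨min (-q) (-deriv ℓ u₀), lt_min (by linarith) (by linarith [h.deriv_neg u₀]),
    fun u hu => ?_⟩
  rcases le_total u (min A B) with h1 | h1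
  · have h2 : deriv ℓ u < q := by exact_mod_cast hA u (h1.trans (min_le_left A B))
    exact (min_le_left _ _).trans (by linarith)
  · exact (min_le_right _ _).trans (neg_le_neg (hu₀ ⟨h1, hu⟩))

/-- The two tail rates are replaced by their minimum, capped at 1 so that second-order errors are
covered by the same exponential. -/
lemma LossShape.exists_expTailRate (h : LossShape ℓ β) (ht : TightExpTail ℓ) :
    ∃ μ U, ExpTailRate (fun u => -deriv ℓ u) β μ U := by
  obtain ⟨μp, μm, U, hp, hm, hU, ht⟩ := ht
  refine ⟨min 1 (min μp μm), U, fun u => neg_pos.2 (h.deriv_neg u), fun u v => ?_,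
    h.exists_le_neg_deriv, by positivity, min_le_left _ _, fun u hu => ?_⟩
  · rw [neg_sub_neg, abs_sub_comm]
    exact h.smooth u v
  · obtain ⟨h1, h2⟩ := ht u hu
    have hu0 : 0 < u := hU.trans hu
    have key : ∀ ν, min 1 (min μp μm) ≤ ν →
        Real.exp (-ν * u) * Real.exp (-u) ≤ Real.exp (-((1 + min 1 (min μp μm)) * u)) := by
      intro ν hν
      rw [← Real.exp_add]
      exact Real.exp_le_exp.2 (by nlinarith)
    have k1 := key μp ((min_le_right _ _).trans (min_le_left _ _))
    have k2 := key μm ((min_le_right _ _).trans (min_le_right _ _))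
    rw [abs_le]
    constructor <;> linarith

variable {d N : ℕ}

lemma gdStep_eq_marginStep (hℓ : Differentiable ℝ ℓ) (η : ℝ) (x : Fin N → EuclideanSpace ℝ (Fin d))
    (y : Fin N → ℝ) (J : Finset (Fin N)) :
    gdStep ℓ η x y J = marginStep (fun u => -deriv ℓ u) η (fun i => y i • x i) J := by
  ext1 w
  have h1 : ∀ i, HasFDerivAt (fun w => ℓ (y i * inner ℝ (x i) w))
      ((deriv ℓ (y i * inner ℝ (x i) w) * y i) • innerSL ℝ (x i)) w := fun i => by
    have h2 : HasFDerivAt (fun w => y i * inner ℝ (x i) w) (y i • innerSL ℝ (x i)) w :=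
      (innerSL ℝ (x i)).hasFDerivAt.const_mul (y i)
    have h3 := (hℓ (y i * inner ℝ (x i) w)).hasDerivAt.comp_hasFDerivAt w h2
    rwa [smul_smul] at h3
  have h4 : HasGradientAt (taskLoss ℓ x y J)
      (∑ i ∈ J, (deriv ℓ (y i * inner ℝ (x i) w) * y i) • x i) w := by
    rw [hasGradientAt_iff_hasFDerivAt]
    have h5 := HasFDerivAt.fun_sum (u := J) fun i _ => h1 i
    refine h5.congr_fderiv ?_
    ext v
    simp
  rw [gdStep, h4.gradient, marginStep, sub_eq_add_neg, ← smul_neg, ← Finset.sum_neg_distrib]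
  congr 2
  refine Finset.sum_congr rfl fun i _ => ?_
  rw [real_inner_smul_left, smul_smul, neg_mul, neg_smul]

end Loss

/-! ### The largest singular value as an operator norm. -/

section Sigma

variable {d N : ℕ} (x : Fin N → EuclideanSpace ℝ (Fin d))

lemma posSemidef_dataMatrix_mul_transpose :
    (dataMatrix x * (dataMatrix x).transpose).PosSemidef := by
  have := Matrix.posSemidef_self_mul_conjTranspose (dataMatrix x)
  rwa [Matrix.conjTranspose_eq_transpose_of_trivial] at this

lemma sigmaMax_sq :
    sigmaMax x ^ 2 = lambdaMax (dataMatrix x * (dataMatrix x).transpose) := by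
  rw [sigmaMax, Real.sq_sqrt]
  exact Real.sSup_nonneg
    (Matrix.posSemidef_iff_isHermitian_and_spectrum_nonneg.1
      (posSemidef_dataMatrix_mul_transpose x)).2

/-- The left side is the quadratic form of $XX^\top$, and $\lambda_{\max}-XX^\top$ is positive
semidefinite because its spectrum is $\lambda_{\max}$ minus that of $XX^\top$. -/
lemma sum_inner_sq_le (w : EuclideanSpace ℝ (Fin d)) :
    ∑ i, (inner ℝ (x i) w : ℝ) ^ 2 ≤ sigmaMax x ^ 2 * ‖w‖ ^ 2 := by
  set A := dataMatrix x * (dataMatrix x).transpose with hA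
  have h1 := posSemidef_dataMatrix_mul_transpose x
  have h2 : (algebraMap ℝ _ (lambdaMax A) - A).PosSemidef := by
    refine Matrix.posSemidef_iff_isHermitian_and_spectrum_nonneg.2 ⟨?_, ?_⟩
    · refine Matrix.IsHermitian.sub ?_ h1.isHermitian
      rw [Algebra.algebraMap_eq_smul_one]
      exact Matrix.isHermitian_one.smul (IsSelfAdjoint.all (lambdaMax A))
    · rw [← spectrum.singleton_sub_eq]
      rintro _ ⟨_, rfl, r, hr, rfl⟩
      exact sub_nonneg.2 (le_csSup (Matrix.finite_spectrum A).bddAbove hr)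
  have h3 := h2.dotProduct_mulVec_nonneg w.ofLp
  rw [sigmaMax_sq, EuclideanSpace.norm_sq_eq]
  have h4 : w.ofLp ⬝ᵥ Matrix.mulVec A w.ofLp = ∑ i, (inner ℝ (x i) w : ℝ) ^ 2 := by
    rw [hA, ← Matrix.mulVec_mulVec, Matrix.dotProduct_mulVec, ← Matrix.mulVec_transpose]
    simp only [dotProduct, Matrix.mulVec, Matrix.transpose_apply, dataMatrix, Matrix.of_apply,
      PiLp.inner_apply, RCLike.inner_apply, conj_trivial, sq, mul_comm]
  rw [Matrix.sub_mulVec, dotProduct_sub, star_trivial, h4, Algebra.algebraMap_eq_smul_one,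
    Matrix.smul_mulVec, Matrix.one_mulVec, dotProduct_smul] at h3
  have h5 : w.ofLp ⬝ᵥ w.ofLp = ∑ i, ‖w i‖ ^ 2 := by
    simp [dotProduct, sq]
  rw [h5, smul_eq_mul] at h3
  linarith

variable {y : Fin N → ℝ} (hy : ∀ i, y i = 1 ∨ y i = -1)
include hy

lemma sum_inner_signed_sq_le (w : EuclideanSpace ℝ (Fin d)) :
    ∑ i, (inner ℝ (y i • x i) w : ℝ) ^ 2 ≤ sigmaMax x ^ 2 * ‖w‖ ^ 2 := by
  refine le_trans (le_of_eq (Finset.sum_congr rfl fun i _ => ?_)) (sum_inner_sq_le x w)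
  rcases hy i with h | h <;> simp [h]

/-- The bound dual to `sum_inner_signed_sq_le`: pair the sum with itself, apply Cauchy–Schwarz and
cancel one factor `‖u‖ ^ 2`. -/
lemma norm_sum_signed_sq_le (J : Finset (Fin N)) (c : Fin N → ℝ) :
    ‖∑ i ∈ J, c i • y i • x i‖ ^ 2 ≤ sigmaMax x ^ 2 * ∑ i ∈ J, c i ^ 2 := by
  set u := ∑ i ∈ J, c i • y i • x i with hu
  have h1 : ‖u‖ ^ 2 = ∑ i ∈ J, c i * inner ℝ (y i • x i) u := by
    rw [← real_inner_self_eq_norm_sq]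
    conv_lhs => rw [hu]
    rw [sum_inner]
    exact Finset.sum_congr rfl fun i _ => real_inner_smul_left _ _ _
  have h2 := Finset.sum_mul_sq_le_sq_mul_sq J c fun i => (inner ℝ (y i • x i) u : ℝ)
  rw [← h1] at h2
  have h3 : ∑ i ∈ J, (inner ℝ (y i • x i) u : ℝ) ^ 2 ≤ sigmaMax x ^ 2 * ‖u‖ ^ 2 :=
    (Finset.sum_le_sum_of_subset_of_nonneg (Finset.subset_univ _)
      fun _ _ _ => sq_nonneg _).trans (sum_inner_signed_sq_le x hy u)
  have h4 : 0 ≤ ∑ i ∈ J, c i ^ 2 := Finset.sum_nonneg fun _ _ => sq_nonneg _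
  have h5 := mul_le_mul_of_nonneg_left h3 h4
  rcases (sq_nonneg ‖u‖).eq_or_lt with h6 | h6
  · rw [← h6]; positivity
  · refine le_of_mul_le_mul_right ?_ h6
    linarith

lemma norm_signed_sq_le (i : Fin N) : ‖y i • x i‖ ^ 2 ≤ sigmaMax x ^ 2 := by
  have h := norm_sum_signed_sq_le x hy {i} 1
  simpa using h

end Sigma

/-! ### Support vectors of the max-margin solution. -/

section Margin

variable {d N : ℕ} {x : Fin N → EuclideanSpace ℝ (Fin d)} {y : Fin N → ℝ}

lemma mem_supportSet_iff {i : Fin N} :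
    i ∈ supportSet x y ↔ normalizedMargin x y i = margin x y := by
  simp [supportSet]

lemma one_le_inner_maxMargin (h : JointlySeparable x y) (i : Fin N) :
    1 ≤ (inner ℝ (y i • x i) (maxMargin x y) : ℝ) := by
  rw [real_inner_smul_left]
  exact ((isMaxMargin_iff h _).2 rfl).1 i

lemma norm_maxMargin_pos (h : JointlySeparable x y) (i : Fin N) : 0 < ‖maxMargin x y‖ := by
  rw [norm_pos_iff]
  intro h0
  have := one_le_inner_maxMargin h i
  rw [h0, inner_zero_right] at this
  linarith

/-- A support vector attains the smallest margin `q`. If `q > 1`, then `q⁻¹ • v` would be feasible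
with smaller norm. -/
lemma inner_maxMargin_eq_one (h : JointlySeparable x y) {i : Fin N} (hi : i ∈ supportSet x y) :
    (inner ℝ (y i • x i) (maxMargin x y) : ℝ) = 1 := by
  set v := maxMargin x y with hv
  have hv0 : 0 < ‖v‖ := norm_maxMargin_pos h i
  set q : ℝ := inner ℝ (y i • x i) v with hq
  have hq1 : 1 ≤ q := one_le_inner_maxMargin h i
  have hmin : ∀ j, q ≤ y j * inner ℝ (x j) v := fun j => by
    have h1 : normalizedMargin x y i ≤ normalizedMargin x y j := by
      rw [mem_supportSet_iff.1 hi]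
      exact ciInf_le (Set.finite_range _).bddBelow j
    rw [normalizedMargin, normalizedMargin, div_le_div_iff_of_pos_right hv0] at h1
    rwa [hq, real_inner_smul_left]
  have h2 := ((isMaxMargin_iff h _).2 rfl).2 (q⁻¹ • v) fun j => by
    rw [inner_smul_right]
    have := hmin j
    field_simp
    linarith
  rw [← hv, norm_smul, mul_pow, Real.norm_of_nonneg (by positivity), inv_pow] at h2
  by_contra hne
  have hq2 : 1 < q := lt_of_le_of_ne hq1 (Ne.symm hne)
  have h3 : (q ^ 2)⁻¹ < 1 := inv_lt_one_of_one_lt₀ (by nlinarith)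
  have : 0 < ‖v‖ ^ 2 := by positivity
  nlinarith

lemma one_lt_inner_maxMargin (h : JointlySeparable x y) {i₀ : Fin N} (hi₀ : i₀ ∈ supportSet x y)
    {i : Fin N} (hi : i ∉ supportSet x y) :
    1 < (inner ℝ (y i • x i) (maxMargin x y) : ℝ) := by
  refine lt_of_le_of_ne (one_le_inner_maxMargin h i) fun h1 => hi ?_
  rw [mem_supportSet_iff, ← mem_supportSet_iff.1 hi₀, normalizedMargin, normalizedMargin,
    ← real_inner_smul_left, ← real_inner_smul_left, ← h1, inner_maxMargin_eq_one h hi₀]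

/-- Since $\phi=1/\|\hat w\|$, this is Cauchy–Schwarz for a support vector with margin 1. -/
lemma margin_sq_le (h : JointlySeparable x y) {i : Fin N} (hi : i ∈ supportSet x y) :
    margin x y ^ 2 ≤ ‖y i • x i‖ ^ 2 := by
  have hv0 := norm_maxMargin_pos h i
  have h1 := inner_maxMargin_eq_one h hi
  have h2 : margin x y = 1 / ‖maxMargin x y‖ := by
    rw [← mem_supportSet_iff.1 hi, normalizedMargin, ← real_inner_smul_left, h1]
  have h3 := real_inner_le_norm (y i • x i) (maxMargin x y)
  rw [h1] at h3
  rw [h2]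
  gcongr
  rwa [div_le_iff₀ hv0]

/-- A linear relation `c` could be added to the dual variables as `α + ε * c`, still positive for
small `ε`, against their uniqueness. -/
lemma eq_zero_of_sum_supportSet_eq_zero (hnd : NonDegenerate x y) {c : Fin N → ℝ}
    (hc : ∑ i ∈ supportSet x y, c i • y i • x i = 0) :
    ∀ i ∈ supportSet x y, c i = 0 := by
  classical
  obtain ⟨α, ⟨h1, h2, h3⟩, huniq⟩ := hnd
  have h4 : ∀ i : Fin N, ∀ᶠ ε in 𝓝[>] (0 : ℝ), i ∈ supportSet x y → 0 < α i + ε * c i := fun i => by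
    by_cases hi : i ∈ supportSet x y
    · have h5 : Tendsto (fun ε : ℝ => α i + ε * c i) (𝓝 0) (𝓝 (α i + 0 * c i)) :=
        Continuous.tendsto (by fun_prop) 0
      rw [zero_mul, add_zero] at h5
      filter_upwards [(h5.mono_left nhdsWithin_le_nhds).eventually_const_lt (h1 i hi)] with ε hε _
        using hε
    · simp [hi]
  obtain ⟨ε, h6, h7⟩ := ((eventually_all.2 h4).and self_mem_nhdsWithin).exists
  have h8 := huniq (fun i => if i ∈ supportSet x y then α i + ε * c i else 0) ⟨fun i hi => by
    simpa [hi] using h6 i hi, fun i hi => by simp [hi], ?_⟩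
  · intro i hi
    have h9 := congrFun h8 i
    simp only [hi, if_true, add_eq_left, mul_eq_zero] at h9
    exact h9.resolve_left (ne_of_gt h7)
  · have h9 : ∑ i ∈ supportSet x y, (α i + ε * c i) • y i • x i = maxMargin x y := by
      simp only [add_smul, mul_smul]
      rw [Finset.sum_add_distrib, ← Finset.smul_sum, hc, smul_zero, add_zero, h3]
    rw [← h9]
    exact Finset.sum_congr rfl fun i hi => by simp only [if_pos hi]

end Margin

/-! ### Inner products with the support vectors as coordinates on their span. -/

section Coordinates

variable {E ι : Type*} [NormedAddCommGroup E] [InnerProductSpace ℝ E]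
  {z : ι → E} {S : Finset ι}

/-- The coordinates of a vector given by its inner products with the `z i`, `i ∈ S`. -/
noncomputable def innerCoords (z : ι → E) (S : Finset ι) : E →ₗ[ℝ] (S → ℝ) :=
  LinearMap.pi fun i => (innerSL ℝ (z i)).toLinearMap

lemma ker_innerCoords_domRestrict :
    LinearMap.ker ((innerCoords z S).domRestrict (Submodule.span ℝ (z '' S))) = ⊥ := by
  rw [LinearMap.ker_eq_bot']
  rintro ⟨u, hu⟩ h
  have h1 : ∀ i ∈ S, (inner ℝ (z i) u : ℝ) = 0 := fun i hi => congrFun h ⟨i, hi⟩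
  have h2 : u ∈ (Submodule.span ℝ (z '' S))ᗮ := by
    rw [Submodule.mem_orthogonal]
    intro w hw
    induction hw using Submodule.span_induction with
    | mem w hw => obtain ⟨i, hi, rfl⟩ := hw; exact h1 i hi
    | zero => exact inner_zero_left _
    | add a b _ _ ha hb => rw [inner_add_left, ha, hb, add_zero]
    | smul c a _ ha => rw [real_inner_smul_left, ha, mul_zero]
  have h3 := (Submodule.mem_orthogonal _ _).1 h2 u hu
  exact Subtype.ext (inner_self_eq_zero.1 h3)

variable [FiniteDimensional ℝ E]

lemma exists_norm_sq_le_sum_inner_sq (z : ι → E) (S : Finset ι) :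
    ∃ B, 0 < B ∧ ∀ u ∈ Submodule.span ℝ (z '' S),
      ‖u‖ ^ 2 ≤ B * ∑ i ∈ S, (inner ℝ (z i) u : ℝ) ^ 2 := by
  obtain ⟨C, hC, hlip⟩ := LinearMap.exists_antilipschitzWith _
    (ker_innerCoords_domRestrict (z := z) (S := S))
  refine ⟨C ^ 2, by positivity, fun u hu => ?_⟩
  have h1 := hlip.le_mul_dist ⟨u, hu⟩ 0
  rw [dist_zero_right, map_zero, dist_zero_right] at h1
  have h2 : ‖(innerCoords z S).domRestrict (Submodule.span ℝ (z '' S)) ⟨u, hu⟩‖ ≤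
      Real.sqrt (∑ i ∈ S, (inner ℝ (z i) u : ℝ) ^ 2) := by
    refine (pi_norm_le_iff_of_nonneg (Real.sqrt_nonneg _)).2 fun i => Real.abs_le_sqrt ?_
    exact Finset.single_le_sum (f := fun i => (inner ℝ (z i) u : ℝ) ^ 2)
      (fun _ _ => sq_nonneg _) i.2
  have h3 : ‖u‖ ≤ C * Real.sqrt (∑ i ∈ S, (inner ℝ (z i) u : ℝ) ^ 2) := h1.trans (by gcongr)
  calc ‖u‖ ^ 2 ≤ (C * Real.sqrt (∑ i ∈ S, (inner ℝ (z i) u : ℝ) ^ 2)) ^ 2 := by gcongr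
    _ = _ := by rw [mul_pow, Real.sq_sqrt (Finset.sum_nonneg fun _ _ => sq_nonneg _)]

lemma eq_of_sub_mem_span_of_inner_eq {u w : E} (huw : u - w ∈ Submodule.span ℝ (z '' S))
    (h : ∀ i ∈ S, (inner ℝ (z i) u : ℝ) = inner ℝ (z i) w) : u = w := by
  obtain ⟨B, -, hB⟩ := exists_norm_sq_le_sum_inner_sq z S
  have h1 := hB _ huw
  rw [Finset.sum_eq_zero fun i hi => by rw [inner_sub_right, h i hi]; simp, mul_zero] at h1
  have h2 : ‖u - w‖ = 0 := pow_eq_zero_iff two_ne_zero |>.1 (le_antisymm h1 (sq_nonneg _))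
  exact sub_eq_zero.1 (norm_eq_zero.1 h2)

/-- By linear independence the span has dimension `S.card`, so the injective coordinate map is
surjective. -/
lemma exists_mem_span_inner_eq
    (hli : ∀ c : ι → ℝ, ∑ i ∈ S, c i • z i = 0 → ∀ i ∈ S, c i = 0) (t : ι → ℝ) :
    ∃ u ∈ Submodule.span ℝ (z '' S), ∀ i ∈ S, (inner ℝ (z i) u : ℝ) = t i := by
  classical
  have h1 : LinearIndependent ℝ fun i : S => z i := by
    rw [Fintype.linearIndependent_iff]
    intro c hc i
    have h2 := hli (fun i => if hi : i ∈ S then c ⟨i, hi⟩ else 0) (by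
      rw [← Finset.sum_coe_sort]
      refine Eq.trans (Finset.sum_congr rfl fun i _ => ?_) hc
      simp only [i.2, dif_pos, Subtype.coe_eta]) i i.2
    simpa using h2
  have h3 : Module.finrank ℝ (Submodule.span ℝ (z '' S)) = Module.finrank ℝ (S → ℝ) := by
    have h4 := finrank_span_eq_card h1
    have h5 : Set.range (fun i : S => z i) = z '' S := by ext; simp
    rw [h5] at h4
    rw [Module.finrank_fintype_fun_eq_card, h4]
  obtain ⟨u, hu⟩ := (LinearMap.injective_iff_surjective_of_finrank_eq_finrank h3).1
    (LinearMap.ker_eq_bot.1 (ker_innerCoords_domRestrict (z := z) (S := S))) fun i => t i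
  exact ⟨u, u.2, fun i hi => congrFun hu ⟨i, hi⟩⟩

end Coordinates

/-! ### The equations for the limit of the residual. -/

section Residual

variable {d N : ℕ} {x : Fin N → EuclideanSpace ℝ (Fin d)} {y : Fin N → ℝ}

lemma supportSpan_eq_span (hy : ∀ i, y i = 1 ∨ y i = -1) :
    supportSpan x y = Submodule.span ℝ ((fun i => y i • x i) '' supportSet x y) := by
  refine le_antisymm (Submodule.span_le.2 ?_) (Submodule.span_le.2 ?_)
  · rintro _ ⟨i, hi, rfl⟩
    have h1 : x i = y i • y i • x i := by rcases hy i with h | h <;> simp [h]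
    rw [h1]
    exact Submodule.smul_mem _ _ (Submodule.subset_span ⟨i, hi, rfl⟩)
  · rintro _ ⟨i, hi, rfl⟩
    exact Submodule.smul_mem _ _ (Submodule.subset_span ⟨i, hi, rfl⟩)

lemma mem_supportSpan (hspan : Set.finrank ℝ (x '' (supportSet x y : Set (Fin N))) =
    Set.finrank ℝ (Set.range x)) (i : Fin N) : x i ∈ supportSpan x y := by
  have h1 : supportSpan x y = Submodule.span ℝ (Set.range x) :=
    Submodule.eq_of_le_of_finrank_eq (Submodule.span_mono (Set.image_subset_range _ _)) hspan
  rw [h1]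
  exact Submodule.subset_span ⟨i, rfl⟩

lemma isResidualLimit_iff {η : ℝ} {α : Fin N → ℝ} {w₀ v : EuclideanSpace ℝ (Fin d)} :
    IsResidualLimit η x y α w₀ v ↔
      (∀ i ∈ supportSet x y, η * Real.exp (-(inner ℝ (y i • x i) v)) = α i) ∧
        v - w₀ ∈ supportSpan x y := by
  simp only [IsResidualLimit, real_inner_smul_left]
  rw [sub_eq_zero, eq_comm (a := v - w₀), Submodule.starProjection_eq_self_iff]

/-- The system of equations for the limit of the residual has a unique solution. -/
theorem exists_isResidualLimit_iff (hy : ∀ i, y i = 1 ∨ y i = -1) (hnd : NonDegenerate x y) {η : ℝ}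
    (hη : 0 < η) {α : Fin N → ℝ} (hα : ∀ i ∈ supportSet x y, 0 < α i)
    (w₀ : EuclideanSpace ℝ (Fin d)) :
    ∃ wt, ∀ v, IsResidualLimit η x y α w₀ v ↔ v = wt := by
  -- Taking logarithms, the exponential equations prescribe the margins `log (η / α i)`.
  obtain ⟨u, hu, hu'⟩ := exists_mem_span_inner_eq (z := fun i => y i • x i) (S := supportSet x y)
    (fun c => eq_zero_of_sum_supportSet_eq_zero hnd)
    fun i => Real.log (η / α i) - inner ℝ (y i • x i) w₀
  have key : IsResidualLimit η x y α w₀ (w₀ + u) := by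
    refine isResidualLimit_iff.2 ⟨fun i hi => ?_, ?_⟩
    · rw [inner_add_right, hu' i hi, add_sub_cancel, ← Real.log_inv,
        Real.exp_log (inv_pos.2 (div_pos hη (hα i hi)))]
      field_simp
    · rwa [supportSpan_eq_span hy, add_sub_cancel_left]
  refine ⟨w₀ + u, fun v => ⟨fun hv => ?_, fun hv => hv ▸ key⟩⟩
  obtain ⟨h1, h2⟩ := isResidualLimit_iff.1 key
  obtain ⟨h3, h4⟩ := isResidualLimit_iff.1 hv
  refine eq_of_sub_mem_span_of_inner_eq (z := fun i => y i • x i) (S := supportSet x y) ?_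
    fun i hi => ?_
  · rw [← supportSpan_eq_span hy, ← sub_sub_sub_cancel_right _ _ w₀]
    exact Submodule.sub_mem _ h4 h2
  · have h5 := mul_left_cancel₀ hη.ne' ((h3 i hi).trans (h1 i hi).symm)
    exact neg_injective (Real.exp_injective h5)

end Residual

/-! ### Almost sure convergence on the logarithmic time scale. -/

namespace StageSetup

variable {E ι : Type*} [NormedAddCommGroup E] [InnerProductSpace ℝ E] [Fintype ι] {M : ℕ}
  {g : ℝ → ℝ} {β μ U η s : ℝ} {z : ι → E} {v b : E} {S : Finset ι} {α : ι → ℝ}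
  {I : Fin M → Finset ι} {K : ℕ}

/-- The drift inequality at the logarithmic time scale. -/
lemma exists_drift_log (h : StageSetup g β μ U η s z v b S α I K) :
    ∃ ε C c : ℝ, 0 < ε ∧ 0 ≤ C ∧ 0 < c ∧ ∀ᶠ t : ℕ in atTop,
      ∀ w, w - b ∈ Submodule.span ℝ (z '' S) →
      (M : ℝ)⁻¹ * ∑ l, ‖(marginStep g η z (I l))^[K] w - Real.log (t + 1 : ℕ) • v - b‖ ^ 2 ≤
        ‖w - Real.log t • v - b‖ ^ 2 + C * (1 / (t : ℝ) ^ (1 + ε)) -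
          1 / (t : ℝ) * min 1 (c * ‖w - Real.log t • v - b‖ ^ 2) := by
  obtain ⟨ε, C, c, hε, hC, hc, hd⟩ := h.exists_drift
  refine ⟨ε, C, c, hε, hC, hc, ?_⟩
  filter_upwards [(Real.tendsto_log_atTop.comp tendsto_natCast_atTop_atTop).eventually hd,
    eventually_ge_atTop 1] with t ht ht1 w hw
  have ht0 : (0 : ℝ) < t := by exact_mod_cast ht1
  have he : Real.exp (-Real.log t) = 1 / t := by rw [Real.exp_neg, Real.exp_log ht0, one_div]
  have hq : Real.exp (-((1 + ε) * Real.log t)) = 1 / (t : ℝ) ^ (1 + ε) := by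
    rw [Real.exp_neg, Real.rpow_def_of_pos ht0, one_div, mul_comm]
  have hlam : Real.log (t + 1 : ℕ) - Real.log t = Real.log ((t + 1) / t) := by
    rw [Real.log_div (by positivity) ht0.ne']; push_cast; rfl
  have h1 : Real.log ((t + 1) / t) ≤ 1 / t := by
    refine (Real.log_le_sub_one_of_pos (by positivity)).trans (le_of_eq ?_)
    field_simp
    ring
  have h2 : 1 / (t : ℝ) - (1 / t) ^ 2 ≤ Real.log ((t + 1) / t) := by
    refine le_trans ?_ (Real.one_sub_inv_le_log_of_pos (by positivity))
    rw [inv_div, ← sub_nonneg]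
    have : 1 - (t : ℝ) / (t + 1) - (1 / t - (1 / t) ^ 2) = 1 / (t ^ 2 * (t + 1)) := by
      field_simp
      ring
    rw [this]
    positivity
  have h3 := ht (Real.log (t + 1 : ℕ) - Real.log t) (by rw [Function.comp_apply, he, hlam]; exact h2)
    (by rw [Function.comp_apply, he, hlam]; exact h1) w hw
  simp only [Function.comp_apply, add_sub_cancel, he, hq] at h3
  rwa [mul_comm (1 / (t : ℝ))]

/-- Almost surely the starting points of the stages converge to the moving target. -/
theorem ae_tendsto (h : StageSetup g β μ U η s z v b S α I K)
    {Ω : Type*} [MeasurableSpace Ω] {P : Measure Ω} [IsProbabilityMeasure P]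
    {m : ℕ → Ω → Fin M} (hm_meas : ∀ t, Measurable (m t)) (hm_indep : iIndepFun m P)
    (hm_unif : ∀ t (j : Fin M), P (m t ⁻¹' {j}) = (M : ENNReal)⁻¹)
    {w : ℕ → Ω → E} {w₀ : E} (hw0 : ∀ ω, w 0 ω = w₀)
    (hw : ∀ t ω, w (t + 1) ω = (marginStep g η z (I (m t ω)))^[K] (w t ω))
    (hb : w₀ - b ∈ Submodule.span ℝ (z '' S)) :
    ∀ᵐ ω ∂P, Tendsto (fun t : ℕ => w t ω - Real.log t • v) atTop (𝓝 b) := by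
  obtain ⟨ε, C, c, hε, hC, hc, hd⟩ := h.exists_drift_log
  have h1 := ae_tendsto_zero_of_mean_drift hm_meas hm_indep hm_unif hw0 hw
    (F := fun l => (marginStep g η z (I l))^[K])
    (φ := fun t w => ‖w - Real.log t • v - b‖ ^ 2) (fun _ _ => sq_nonneg _)
    (p := fun w => w - b ∈ Submodule.span ℝ (z '' S)) hb (fun j w hw => by
      have h2 := Submodule.add_mem _
        (iterate_marginStep_sub_mem (g := g) (η := η) (J := I j) h.mem_span w K) hw
      rwa [sub_add_sub_cancel] at h2)
    -- At `t = 0` both rates take the default value zero; the drift is needed only for large `t`.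
    (e := fun t => C * (1 / (t : ℝ) ^ (1 + ε))) (fun _ => by positivity)
    ((Real.summable_one_div_nat_rpow.2 (by linarith)).mul_left C)
    (a := fun t => 1 / (t : ℝ)) (fun _ => by positivity) Real.not_summable_one_div_natCast hc hd
  filter_upwards [h1] with ω hω
  rw [tendsto_iff_norm_sub_tendsto_zero]
  have h2 := hω.sqrt
  simpa only [Real.sqrt_sq (norm_nonneg _), Real.sqrt_zero] using h2

/-- If the starting points of the stages converge to the moving target, then so do the iterates
within the stages. -/
lemma tendsto_iterate (h : StageSetup g β μ U η s z v b S α I K) {w : ℕ → E} (m : ℕ → Fin M)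
    (hw : Tendsto (fun t : ℕ => w t - Real.log t • v) atTop (𝓝 b)) (k : ℕ) :
    Tendsto (fun t : ℕ => (marginStep g η z (I (m t)))^[k] (w t) - Real.log t • v) atTop (𝓝 b) := by
  induction k with
  | zero => exact hw
  | succ k ih =>
    set w' := fun t => (marginStep g η z (I (m t)))^[k] (w t) with hw'
    obtain ⟨U₀, hU₀⟩ := h.rate.exists_tail_bounds le_rfl
    have hg : Tendsto g atTop (𝓝 0) := by
      have h1 : Tendsto (fun u : ℝ => 2 * Real.exp (-u)) atTop (𝓝 0) := by
        simpa using Real.tendsto_exp_neg_atTop_nhds_zero.const_mul 2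
      refine squeeze_zero' (Eventually.of_forall fun u => (h.rate.pos u).le) ?_ h1
      filter_upwards [eventually_gt_atTop U₀] with u hu using (hU₀ u hu).2.1
    have hlog : Tendsto (fun t : ℕ => Real.log t) atTop atTop :=
      Real.tendsto_log_atTop.comp tendsto_natCast_atTop_atTop
    -- All margins tend to infinity along with `log t`, so every later step of the stage has
    -- vanishing length.
    have hin : ∀ i, Tendsto (fun t => (inner ℝ (z i) (w' t) : ℝ)) atTop atTop := fun i => by
      have h2 : Tendsto (fun t : ℕ => (inner ℝ (z i) (w' t - Real.log t • v) : ℝ)) atTop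
          (𝓝 (inner ℝ (z i) b)) := tendsto_const_nhds.inner ih
      have h3 := h2.add_atTop (hlog.atTop_mul_const
        (zero_lt_one.trans_le (h.one_le_margin i)))
      refine h3.congr fun t => ?_
      rw [inner_sub_right, inner_smul_right]
      ring
    have hsum : Tendsto (fun t => ∑ i, g (inner ℝ (z i) (w' t)) * ‖z i‖) atTop (𝓝 0) := by
      have h4 := tendsto_finsetSum (Finset.univ : Finset ι) fun i _ =>
        (hg.comp (hin i)).mul_const ‖z i‖
      simpa using h4
    have hstep : Tendsto (fun t => marginStep g η z (I (m t)) (w' t) - w' t) atTop (𝓝 0) := by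
      refine squeeze_zero_norm (fun t => ?_) (by simpa using hsum.const_mul η)
      rw [marginStep, add_sub_cancel_left, norm_smul, Real.norm_of_nonneg h.η_pos.le]
      refine mul_le_mul_of_nonneg_left ?_ h.η_pos.le
      calc ‖∑ i ∈ I (m t), g (inner ℝ (z i) (w' t)) • z i‖
          ≤ ∑ i ∈ I (m t), g (inner ℝ (z i) (w' t)) * ‖z i‖ := by
            refine norm_sum_le_of_le _ fun i _ => ?_
            rw [norm_smul, Real.norm_of_nonneg (h.rate.pos _).le]
        _ ≤ _ := Finset.sum_le_sum_of_subset_of_nonneg (Finset.subset_univ _)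
            fun i _ _ => mul_nonneg (h.rate.pos _).le (norm_nonneg _)
    have h5 := hstep.add ih
    rw [zero_add] at h5
    refine h5.congr fun t => ?_
    rw [Function.iterate_succ_apply', sub_add_sub_cancel]

end StageSetup

/-! ### The assumptions of the theorem as a stage setup, and the conclusion. -/

section Setup

variable {d N M K : ℕ} {x : Fin N → EuclideanSpace ℝ (Fin d)} {y : Fin N → ℝ}
  {I : Fin M → Finset (Fin N)} {ℓ : ℝ → ℝ} {β η : ℝ}

/-- One factor $\sigma_{\max}^2$ cancels because $\phi\le\|x_i\|\le\sigma_{\max}$ for a support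
vector. A nonpositive denominator would make the bound on `η` nonpositive. -/
lemma mul_sigmaMax_sq_mul_lt (hy : ∀ i, y i = 1 ∨ y i = -1) (hsep : JointlySeparable x y)
    (hη_pos : 0 < η) (hη : η < 2 * margin x y ^ 2 / (β * sigmaMax x ^ 4)) {i : Fin N}
    (hi : i ∈ supportSet x y) : η * sigmaMax x ^ 2 * β < 2 := by
  have h1 : 0 < β * sigmaMax x ^ 4 := by
    by_contra h0
    have := div_nonpos_of_nonneg_of_nonpos (by positivity : 0 ≤ 2 * margin x y ^ 2) (not_lt.1 h0)
    linarith
  rw [lt_div_iff₀ h1] at hη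
  have h2 := (margin_sq_le hsep hi).trans (norm_signed_sq_le x hy i)
  have h3 : 0 < sigmaMax x ^ 2 := by
    refine lt_of_le_of_ne (sq_nonneg _) fun h0 => h1.ne' ?_
    have : sigmaMax x ^ 4 = (sigmaMax x ^ 2) ^ 2 := by ring
    rw [this, ← h0]
    ring
  refine lt_of_mul_lt_mul_right ?_ h3.le
  calc η * sigmaMax x ^ 2 * β * sigmaMax x ^ 2 = η * (β * sigmaMax x ^ 4) := by ring
    _ < 2 * margin x y ^ 2 := hη
    _ ≤ 2 * sigmaMax x ^ 2 := by linarith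

/-- The shift $\ln(K/M)\hat w$ in the target multiplies $e^{-\langle z_i,\tilde w\rangle}$ by $M/K$.
This offsets the $K$ steps per stage and the probability $1/M$ of the task, so the balance $\eta
e^{-\langle z_i,\tilde w\rangle}=\alpha_i$ remains. -/
lemma exists_stageSetup (hK : 1 ≤ K) (hM : 0 < M) (hy : ∀ i, y i = 1 ∨ y i = -1)
    (hI : ∀ i : Fin N, ∃! j : Fin M, i ∈ I j) (hsep : JointlySeparable x y)
    (hshape : LossShape ℓ β) (htail : TightExpTail ℓ)
    (hη_pos : 0 < η) (hη : η < 2 * margin x y ^ 2 / (β * sigmaMax x ^ 4))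
    (hspan : Set.finrank ℝ (x '' (supportSet x y : Set (Fin N))) = Set.finrank ℝ (Set.range x))
    {i₀ : Fin N} (hi₀ : i₀ ∈ supportSet x y) {α : Fin N → ℝ} (hα : IsDual x y α)
    {w₀ wt : EuclideanSpace ℝ (Fin d)} (hwt : IsResidualLimit η x y α w₀ wt) :
    ∃ μ U, StageSetup (fun u => -deriv ℓ u) β μ U η (η * sigmaMax x ^ 2) (fun i => y i • x i)
      (maxMargin x y) (Real.log ((K : ℝ) / M) • maxMargin x y + wt) (supportSet x y) α I K := by
  obtain ⟨μ, U, hrate⟩ := hshape.exists_expTailRate htail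
  have hK0 : (0 : ℝ) < K := by exact_mod_cast hK
  have hM0 : (0 : ℝ) < M := by exact_mod_cast hM
  exact ⟨μ, U,
    { rate := hrate
      η_pos := hη_pos
      s_nonneg := by positivity
      s_lt := mul_sigmaMax_sq_mul_lt hy hsep hη_pos hη hi₀
      norm_sum_le := fun J c => by
        rw [mul_assoc]
        exact mul_le_mul_of_nonneg_left (norm_sum_signed_sq_le x hy J c) hη_pos.le
      stage_pos := hK
      task_pos := hM
      partition := hI
      eq_sum := hα.2.2
      dual_pos := hα.1
      margin_eq := fun i hi => inner_maxMargin_eq_one hsep hi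
      margin_gt := fun i hi => one_lt_inner_maxMargin hsep hi₀ hi
      target := fun i hi => by
        rw [inner_add_right, inner_smul_right, inner_maxMargin_eq_one hsep hi, mul_one, neg_add,
          Real.exp_add, ← Real.log_inv, Real.exp_log (by positivity),
          ← (isResidualLimit_iff.1 hwt).1 i hi]
        field_simp
      coercive := exists_norm_sq_le_sum_inner_sq _ _
      mem_span := fun i => by
        rw [← supportSpan_eq_span hy]
        exact Submodule.smul_mem _ _ (mem_supportSpan hspan i) }⟩

end Setup

end ContinualGD

theorem mainTheorem10 {d N M K : ℕ} (hK : 1 ≤ K)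
    -- the data, and its partition into tasks
    (x : Fin N → EuclideanSpace ℝ (Fin d)) (y : Fin N → ℝ) (hy : ∀ i, y i = 1 ∨ y i = -1)
    (I : Fin M → Finset (Fin N)) (hI : ∀ i : Fin N, ∃! j : Fin M, i ∈ I j)
    -- the loss, the learning rate and the starting point
    (ℓ : ℝ → ℝ) (β η : ℝ) (w₀ : EuclideanSpace ℝ (Fin d))
    -- the random task order
    {Ω : Type*} [MeasurableSpace Ω] (P : Measure Ω) [IsProbabilityMeasure P]
    (m : ℕ → Ω → Fin M) (hm_meas : ∀ t, Measurable (m t)) (hm_indep : iIndepFun m P)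
    (hm_unif : ∀ t (j : Fin M), P (m t ⁻¹' {j}) = (M : ENNReal)⁻¹)
    -- the assumptions
    (hsep : ContinualGD.JointlySeparable x y)
    (hnd : ContinualGD.NonDegenerate x y)
    (hshape : ContinualGD.LossShape ℓ β)
    (htail : ContinualGD.TightExpTail ℓ)
    (hη_pos : 0 < η)
    (hη : η < 2 * ContinualGD.margin x y ^ 2 / (β * ContinualGD.sigmaMax x ^ 4))
    (hspan : Set.finrank ℝ (x '' (ContinualGD.supportSet x y : Set (Fin N))) =
      Set.finrank ℝ (Set.range x))
    (htask : ∀ j : Fin M, ∃ i ∈ I j, i ∈ ContinualGD.supportSet x y)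
    -- the dual variables
    (α : Fin N → ℝ) (hα : ContinualGD.IsDual x y α) :
    ∃ wtilde : EuclideanSpace ℝ (Fin d),
      (∀ v : EuclideanSpace ℝ (Fin d),
        ContinualGD.IsResidualLimit η x y α w₀ v ↔ v = wtilde) ∧
      ∀ᵐ ω ∂P, ∀ k < K,
        Tendsto (fun t : ℕ =>
            ContinualGD.seqGD ℓ η K x y I (fun s => m s ω) w₀ t k -
              Real.log ((K : ℝ) / M * t) • ContinualGD.maxMargin x y)
          atTop (𝓝 wtilde) ∧
        Tendsto (fun t : ℕ =>
            ContinualGD.seqGD ℓ η K x y I (fun s => m s ω) w₀ t k -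
              Real.log t • ContinualGD.maxMargin x y)
          atTop (𝓝 (Real.log ((K : ℝ) / M) • ContinualGD.maxMargin x y + wtilde)) := by
  obtain ⟨wt, hwt⟩ := ContinualGD.exists_isResidualLimit_iff hy hnd hη_pos hα.1 w₀
  refine ⟨wt, hwt, ?_⟩
  obtain ⟨ω₀⟩ : Nonempty Ω := nonempty_of_isProbabilityMeasure P
  have hM : 0 < M := (m 0 ω₀).pos
  -- The support set is nonempty because a task exists and contains a support vector.
  obtain ⟨i₀, -, hi₀⟩ := htask (m 0 ω₀)
  have hlim := (hwt wt).2 rfl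
  obtain ⟨μ, U, h⟩ := ContinualGD.exists_stageSetup hK hM hy hI hsep hshape htail hη_pos hη hspan hi₀
    hα hlim
  have hb : w₀ - (Real.log ((K : ℝ) / M) • ContinualGD.maxMargin x y + wt) ∈
      Submodule.span ℝ ((fun i => y i • x i) '' (ContinualGD.supportSet x y : Set (Fin N))) := by
    have h1 := (ContinualGD.isResidualLimit_iff.1 hlim).2
    rw [ContinualGD.supportSpan_eq_span hy] at h1
    have h2 := Submodule.neg_mem _ (Submodule.add_mem _ h1
      (Submodule.smul_mem _ (Real.log ((K : ℝ) / M)) h.direction_mem_span))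
    convert h2 using 1
    abel
  have hae := h.ae_tendsto hm_meas hm_indep hm_unif
    (w := fun t ω => ContinualGD.stageStart ℓ η K x y I (fun s => m s ω) w₀ t) (w₀ := w₀)
    (fun _ => rfl)
    (fun t ω => by
      rw [← ContinualGD.gdStep_eq_marginStep hshape.differentiable]
      rfl) hb
  filter_upwards [hae] with ω hω k _
  have hk := h.tendsto_iterate (fun t => m t ω) hω k
  simp only [← ContinualGD.gdStep_eq_marginStep hshape.differentiable] at hk
  have hk' : Tendsto (fun t : ℕ => ContinualGD.seqGD ℓ η K x y I (fun s => m s ω) w₀ t k -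
      Real.log t • ContinualGD.maxMargin x y) atTop
      (𝓝 (Real.log ((K : ℝ) / M) • ContinualGD.maxMargin x y + wt)) := hk
  refine ⟨?_, hk'⟩
  have h1 := hk'.sub_const (Real.log ((K : ℝ) / M) • ContinualGD.maxMargin x y)
  rw [add_sub_cancel_left] at h1
  refine h1.congr' ?_
  -- The logarithm of the product is split only for `t ≥ 1`, away from the default value `log 0 =
  -- 0`.
  filter_upwards [eventually_ge_atTop 1] with t ht
  have hK0 : (K : ℝ) ≠ 0 := by positivity
  have hM0 : (M : ℝ) ≠ 0 := by positivity
  have ht0 : (t : ℝ) ≠ 0 := by positivity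
  rw [Real.log_mul (div_ne_zero hK0 hM0) ht0, add_smul, sub_sub, add_comm]
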